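/- Let $d\ge 2$ be an integer. For a closed set $E\subset\mathbb R^d$ let $|E|$ be its Lebesgue measure and $$P(E)=\sup\Big\{\int_E \operatorname{div}\varphi\,dx:\ \varphi\in C^1_c(\mathbb R^d;\mathbb R^d),\ |\varphi|\le 1\Big\}$$ its perimeter. For $\alpha>0$ and a Borel set $A\subset\mathbb R^d$ let $$\mathcal I_\alpha(A)=\inf\Big\{\int_{\mathbb R^d}\int_{\mathbb R^d}\frac{d\mu(x)\,d\mu(y)}{|x-y|^\alpha}:\ \mu \text{ a Borel measure on }\mathbb R^d,\ \mu(A)=1\Big\}\in[0,+\infty],$$ and for $Q>0$ let $$\mathcal F_{\alpha,Q}(E)=P(E)+Q^2\,\mathcal I_\alpha(E),\qquad \mathcal G_{\alpha,Q}(E)=P(E)+Q^2\,\mathcal I_\alpha(\partial E).$$ For $\delta>0$ let $\mathcal K_\delta$ be the class of all closed sets $E\subset\mathbb R^d$ that satisfy the $\delta$-ball condition: for every $x\in\partial E$ there are two open balls of radius $\delta$ having $x$ on their boundary spheres, one contained in $E$ and the other contained in $\mathbb R^d\setminus E$. **Theorem.** For every $\alpha\in(0,1)$ there exist constants $c_0>0$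 and $Q_0>0$, depending only on $\alpha$ and on the dimension $d$, such that for every $\delta>0$, every $m\ge c_0\,\delta^d$ and every $Q$ with $$\frac{Q}{m^{\frac{d-1+\alpha}{2d}}}\;>\;Q_0\left(\frac{m}{\delta^d}\right)^{\frac{d\alpha+1-\alpha}{2d}},$$ neither of the problems $$\min\{\mathcal F_{\alpha,Q}(E):\ |E|=m,\ E\in\mathcal K_\delta\},\qquad \min\{\mathcal G_{\alpha,Q}(E):\ |E|=m,\ E\in\mathcal K_\delta\}$$ has a solution. -/

import Mathlib

open MeasureTheory
open scoped ENNReal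

namespace ChargedDrops

/-- The divergence of a vector field on `ℝᵈ`: the sum of the partial derivatives `∂ᵢ φᵢ`. -/
noncomputable def divergence {d : ℕ}
    (φ : EuclideanSpace ℝ (Fin d) → EuclideanSpace ℝ (Fin d))
    (x : EuclideanSpace ℝ (Fin d)) : ℝ :=
  ∑ i : Fin d, (fderiv ℝ φ x (EuclideanSpace.single i 1)) i

/-- The (De Giorgi) perimeter of a Borel set `E`, i.e. the total variation of its indicator:
the supremum of `∫_E div φ` over the `C¹` fields with compact support and `|φ| ≤ 1`.
The field `φ = 0` is admissible, so truncating negative values at `0` does not matter. -/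
noncomputable def perimeter {d : ℕ} (E : Set (EuclideanSpace ℝ (Fin d))) : ℝ≥0∞ :=
  ⨆ (φ : EuclideanSpace ℝ (Fin d) → EuclideanSpace ℝ (Fin d)) (_ : ContDiff ℝ 1 φ)
    (_ : HasCompactSupport φ) (_ : ∀ x, ‖φ x‖ ≤ 1),
    ENNReal.ofReal (∫ x in E, divergence φ x)

/-- The interaction energy `∬ |x - y|^{-α} dμ(x) dμ(y)` of a Borel measure, with values in
`[0, ∞]`; the kernel is `+∞` on the diagonal. -/
noncomputable def rieszEnergyMeasure {d : ℕ} (α : ℝ)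
    (μ : Measure (EuclideanSpace ℝ (Fin d))) : ℝ≥0∞ :=
  ∫⁻ x, ∫⁻ y, ((edist x y) ^ α)⁻¹ ∂μ ∂μ

/-- The Riesz potential energy of a set: the infimum of the interaction energies of the
Borel measures on `ℝᵈ` that give the set mass `1`. -/
noncomputable def rieszEnergy {d : ℕ} (α : ℝ)
    (A : Set (EuclideanSpace ℝ (Fin d))) : ℝ≥0∞ :=
  ⨅ (μ : Measure (EuclideanSpace ℝ (Fin d))) (_ : μ A = 1), rieszEnergyMeasure α μ

/-- The functional `P(E) + Q² I_α(E)`. -/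
noncomputable def functionalF {d : ℕ} (α Q : ℝ)
    (E : Set (EuclideanSpace ℝ (Fin d))) : ℝ≥0∞ :=
  perimeter E + ENNReal.ofReal (Q ^ 2) * rieszEnergy α E

/-- The functional `P(E) + Q² I_α(∂E)`. -/
noncomputable def functionalG {d : ℕ} (α Q : ℝ)
    (E : Set (EuclideanSpace ℝ (Fin d))) : ℝ≥0∞ :=
  perimeter E + ENNReal.ofReal (Q ^ 2) * rieszEnergy α (frontier E)

/-- Every boundary point is touched by a ball of radius `δ` contained in `E`. -/
def InternalBallCondition {d : ℕ} (δ : ℝ) (E : Set (EuclideanSpace ℝ (Fin d))) : Prop :=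
  ∀ x ∈ frontier E, ∃ c, x ∈ Metric.sphere c δ ∧ Metric.ball c δ ⊆ E

/-- Every boundary point is touched by a ball of radius `δ` contained in the complement. -/
def ExternalBallCondition {d : ℕ} (δ : ℝ) (E : Set (EuclideanSpace ℝ (Fin d))) : Prop :=
  ∀ x ∈ frontier E, ∃ c, x ∈ Metric.sphere c δ ∧ Metric.ball c δ ⊆ Eᶜ

/-- The class of closed subsets of `ℝᵈ` that satisfy the `δ`-ball condition. -/
def ballClass (d : ℕ) (δ : ℝ) : Set (Set (EuclideanSpace ℝ (Fin d))) :=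
  {E | IsClosed E ∧ InternalBallCondition δ E ∧ ExternalBallCondition δ E}

/-- `E` solves the problem of minimizing `J` among the sets of the class `K` of volume `m`. -/
def IsVolumeMinimizer {d : ℕ} (J : Set (EuclideanSpace ℝ (Fin d)) → ℝ≥0∞)
    (K : Set (Set (EuclideanSpace ℝ (Fin d)))) (m : ℝ)
    (E : Set (EuclideanSpace ℝ (Fin d))) : Prop :=
  E ∈ K ∧ volume E = ENNReal.ofReal m ∧
    ∀ E' ∈ K, volume E' = ENNReal.ofReal m → J E ≤ J E'

end ChargedDrops

namespace ChargedDrops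

open Metric Set Filter Topology

/-! Write `m = M δ ^ d`. A minimizer cannot spread its charge over far apart pieces, while a
competitor can.

Cut a minimizer `E` into classes of points joined by chains in `E` with steps shorter than `δ`.
Distinct classes are at distance at least `δ`. By the internal ball condition, points of `E` that
are `6 δ` apart carry disjoint `δ`-balls of `E`, so a class has diameter at most a constant times `M
δ` (`InternalBallCondition.dist_le_of_mem_chainClass`). A class can be moved arbitrarily far from
the rest without leaving `ballClass`, changing the volume or increasing the perimeter
(`translatedUnion_mem_ballClass`, `perimeter_translatedUnion_le`), and the move removes the
interaction between the two parts (`rieszEnergy_translate_add_le`). By minimality almost nothing can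
be gained, so a nearly optimal charge has at least half of its mass on one class. The energy is then
at least of order `(M δ) ^ (-α)` (`le_rieszEnergy_of_isVolumeMinimizer`).

On the other hand, about `M` distant balls of radius about `δ` have perimeter at most of order `M δ
^ (d - 1)`. Charging an arc on each sphere equally gives energy at most of order `1 / (M δ ^ α)`
(`exists_competitor_bound`). Since `α < 1`, arcs have finite energy and `M ^ α` is negligible
against `M` for large `M`. The lower bound then exceeds twice the energy term of the competitor, and
the assumption on `Q` makes it exceed twice the perimeter term as well, a contradiction.

Both functionals are handled at once by letting the charge live on `κ E`, with `κ` the identity or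
the boundary (`IsChargeCarrier`). -/

/-! ### Packing consequences of the internal ball condition -/

theorem inter_frontier_nonempty_of_isPreconnected {X : Type*} [TopologicalSpace X] {s t : Set X}
    (hs : IsPreconnected s) (h1 : (s ∩ t).Nonempty) (h2 : (s ∩ tᶜ).Nonempty) :
    (s ∩ frontier t).Nonempty := by
  by_contra h
  have hf : ∀ x ∈ s, x ∉ frontier t := fun x hx hxt => h ⟨x, hx, hxt⟩
  have hi : ∀ x ∈ s, x ∈ t → x ∈ interior t := fun x hx hxt => by
    by_contra hxi
    exact hf x hx ⟨subset_closure hxt, hxi⟩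
  have hc : ∀ x ∈ s, x ∉ t → x ∈ (closure t)ᶜ := fun x hx hxt hxc =>
    hf x hx ⟨hxc, fun hxi => hxt (interior_subset hxi)⟩
  obtain ⟨x, hx, hxt⟩ := h1
  obtain ⟨y, hy, hyt⟩ := h2
  obtain ⟨z, -, hz1, hz2⟩ := hs _ _ isOpen_interior isClosed_closure.isOpen_compl
    (fun z hz => by
      by_cases hzt : z ∈ t
      · exact Or.inl (hi z hz hzt)
      · exact Or.inr (hc z hz hzt)) ⟨x, hx, hi x hx hxt⟩ ⟨y, hy, hc y hy hyt⟩
  exact hz2 (subset_closure (interior_subset hz1))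

/-- A point of a set touched by a ball of the complement is a boundary point. -/
theorem mem_frontier_of_ball_subset_compl {d : ℕ} {E : Set (EuclideanSpace ℝ (Fin d))}
    {x c : EuclideanSpace ℝ (Fin d)} {δ : ℝ} (hδ : 0 < δ) (hx : x ∈ E)
    (hc : x ∈ sphere c δ) (hE : ball c δ ⊆ Eᶜ) : x ∈ frontier E := by
  rw [frontier_eq_closure_inter_closure]
  refine ⟨subset_closure hx, closure_mono hE ?_⟩
  rw [closure_ball c hδ.ne']
  exact sphere_subset_closedBall hc

/-- If the `δ`-ball at `x` leaves `E`, it contains a boundary point; the centre of the interior ball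
touching there is within `2 δ` of `x`. -/
theorem InternalBallCondition.exists_ball_subset {d : ℕ} {E : Set (EuclideanSpace ℝ (Fin d))}
    {δ : ℝ} (hE : InternalBallCondition δ E) (hδ : 0 < δ) {x : EuclideanSpace ℝ (Fin d)}
    (hx : x ∈ E) : ∃ c, ball c δ ⊆ E ∧ ball c δ ⊆ ball x (3 * δ) := by
  by_cases h : ball x δ ⊆ E
  · exact ⟨x, h, ball_subset_ball (by linarith)⟩
  · obtain ⟨y, hy, hyE⟩ := not_subset.1 h
    obtain ⟨z, hz, hzf⟩ := inter_frontier_nonempty_of_isPreconnected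
      (convex_ball x δ).isPreconnected ⟨x, mem_ball_self hδ, hx⟩ ⟨y, hy, hyE⟩
    obtain ⟨c, hc, hcE⟩ := hE z hzf
    refine ⟨c, hcE, ball_subset_ball' ?_⟩
    have h1 := mem_sphere.1 hc
    have h2 := mem_ball.1 hz
    have h3 := dist_triangle_left c x z
    linarith

/-- The separation `6 δ` makes the balls `ball (z k) (3 * δ)` disjoint, and each contains a `δ`-ball
of `E`. -/
theorem InternalBallCondition.card_mul_le {d : ℕ} {E : Set (EuclideanSpace ℝ (Fin d))}
    {δ : ℝ} (hE : InternalBallCondition δ E) (hδ : 0 < δ) (n : ℕ)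
    (z : ℕ → EuclideanSpace ℝ (Fin d)) (hz : ∀ k < n, z k ∈ E)
    (hsep : ∀ i < n, ∀ j < n, i < j → 6 * δ ≤ dist (z i) (z j)) :
    n * volume (ball (0 : EuclideanSpace ℝ (Fin d)) δ) ≤ volume E := by
  have h : ∀ k, ∃ c, k < n → ball c δ ⊆ E ∧ ball c δ ⊆ ball (z k) (3 * δ) := fun k => by
    by_cases hk : k < n
    · obtain ⟨c, hc⟩ := hE.exists_ball_subset hδ (hz k hk)
      exact ⟨c, fun _ => hc⟩
    · exact ⟨0, fun h => absurd h hk⟩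
  choose c hc using h
  have hlt : ∀ i < n, ∀ j < n, i < j → Disjoint (ball (c i) δ) (ball (c j) δ) :=
    fun i hi j hj hij => (ball_disjoint_ball (by linarith [hsep i hi j hj hij])).mono
      (hc i hi).2 (hc j hj).2
  have hdis : Set.PairwiseDisjoint (↑(Finset.range n)) fun k => ball (c k) δ := by
    intro i hi j hj hij
    simp only [Finset.coe_range, mem_Iio] at hi hj
    rcases lt_or_gt_of_ne hij with h | h
    · exact hlt i hi j hj h
    · exact (hlt j hj i hi h).symm
  calc (n : ℝ≥0∞) * volume (ball (0 : EuclideanSpace ℝ (Fin d)) δ)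
      = ∑ k ∈ Finset.range n, volume (ball (c k) δ) := by
        simp [Measure.addHaar_ball_center]
    _ = volume (⋃ k ∈ Finset.range n, ball (c k) δ) :=
        (measure_biUnion_finset hdis fun _ _ => measurableSet_ball).symm
    _ ≤ volume E := measure_mono <| iUnion₂_subset fun k hk => (hc k (Finset.mem_range.1 hk)).1

theorem InternalBallCondition.isBounded {d : ℕ} {E : Set (EuclideanSpace ℝ (Fin d))}
    {δ : ℝ} (hE : InternalBallCondition δ E) (hδ : 0 < δ) (hvol : volume E ≠ ∞) :
    Bornology.IsBounded E := by
  by_contra hb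
  -- Finitely many balls of radius `6 δ` cannot cover an unbounded set, so a `6 δ`-separated
  -- sequence can be extended forever.
  obtain ⟨f, hf, hsep⟩ := exists_seq_of_forall_finset_exists (fun x => x ∈ E)
    (fun x y => 6 * δ ≤ dist x y) (fun s _ => by
      by_contra! h
      refine hb ((Bornology.isBounded_biUnion_finset s |>.2 fun x _ =>
        (isBounded_ball (x := x) (r := 6 * δ))).subset fun y hy => ?_)
      obtain ⟨x, hx, hxy⟩ := h y hy
      exact mem_biUnion hx (by rwa [mem_ball, dist_comm]))
  have hpos : volume (ball (0 : EuclideanSpace ℝ (Fin d)) δ) ≠ 0 :=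
    (measure_ball_pos _ _ hδ).ne'
  obtain ⟨n, hn⟩ := ENNReal.exists_nat_mul_gt hpos hvol
  exact absurd (hE.card_mul_le hδ n f (fun k _ => hf k) fun i _ j _ hij => hsep i j hij)
    (not_le.2 hn)

/-! ### Chain classes and their diameter -/

/-- The points of `E` that a chain in `E` with steps shorter than `δ` joins to `x`. -/
def chainClass {d : ℕ} (δ : ℝ) (E : Set (EuclideanSpace ℝ (Fin d)))
    (x : EuclideanSpace ℝ (Fin d)) : Set (EuclideanSpace ℝ (Fin d)) :=
  {y | Relation.ReflTransGen (fun a b => b ∈ E ∧ dist a b < δ) x y}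

theorem chainClass_subset {d : ℕ} {δ : ℝ} {E : Set (EuclideanSpace ℝ (Fin d))}
    {x : EuclideanSpace ℝ (Fin d)} (hx : x ∈ E) : chainClass δ E x ⊆ E := by
  intro y hy
  induction hy with
  | refl => exact hx
  | tail _ h _ => exact h.1

theorem mem_chainClass_of_dist_lt {d : ℕ} {δ : ℝ} {E : Set (EuclideanSpace ℝ (Fin d))}
    {x y z : EuclideanSpace ℝ (Fin d)} (hy : y ∈ chainClass δ E x) (hz : z ∈ E)
    (hyz : dist y z < δ) : z ∈ chainClass δ E x :=
  Relation.ReflTransGen.tail hy ⟨hz, hyz⟩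

/-- A discrete intermediate value argument: the distance to `x` grows by less than `δ` at each step
of a chain. -/
theorem exists_mem_chainClass_dist {d : ℕ} {δ : ℝ} (hδ : 0 < δ)
    {E : Set (EuclideanSpace ℝ (Fin d))} {x y : EuclideanSpace ℝ (Fin d)}
    (hy : y ∈ chainClass δ E x) {t : ℝ} (ht : 0 ≤ t) (hty : t ≤ dist x y) :
    ∃ z ∈ chainClass δ E x, t ≤ dist x z ∧ dist x z < t + δ := by
  induction hy with
  | refl => exact ⟨x, .refl, hty, by rw [dist_self]; linarith⟩
  | @tail b c hb hc ih =>
    by_cases h : t ≤ dist x b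
    · exact ih h
    · refine ⟨c, .tail hb hc, hty, ?_⟩
      have := dist_triangle x b c
      linarith [hc.2]

/-- The radius of a chain class is controlled by the volume. -/
theorem InternalBallCondition.dist_le_of_mem_chainClass {d : ℕ} {δ : ℝ} (hδ : 0 < δ)
    {E : Set (EuclideanSpace ℝ (Fin d))} (hE : InternalBallCondition δ E) {m : ℝ} (hm : 0 ≤ m)
    (hvol : volume E = ENNReal.ofReal m) {x y : EuclideanSpace ℝ (Fin d)} (hx : x ∈ E)
    (hy : y ∈ chainClass δ E x) :
    dist x y * (volume.real (ball (0 : EuclideanSpace ℝ (Fin d)) 1) * δ ^ d) ≤ 7 * δ * m := by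
  -- This counts the multiples of `7 δ`, zero included, up to `dist x y`. Points chosen in windows
  -- of width `δ` above these multiples are still `6 δ` apart.
  set n := ⌊dist x y / (7 * δ)⌋₊ + 1 with hn
  have h7 : 0 < 7 * δ := by linarith
  have key : ∀ k : ℕ, ∃ z, k < n → z ∈ chainClass δ E x ∧ k * (7 * δ) ≤ dist x z ∧
      dist x z < k * (7 * δ) + δ := fun k => by
    by_cases hk : k < n
    · have h1 : (k : ℝ) ≤ dist x y / (7 * δ) :=
        (Nat.le_floor_iff (by positivity)).1 (by omega)
      obtain ⟨z, hz⟩ := exists_mem_chainClass_dist hδ hy (t := k * (7 * δ)) (by positivity)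
        ((le_div_iff₀ h7).1 h1)
      exact ⟨z, fun _ => hz⟩
    · exact ⟨0, fun h => absurd h hk⟩
  choose z hz using key
  have hcard := hE.card_mul_le hδ n z (fun k hk => chainClass_subset hx (hz k hk).1)
    (fun i hi j hj hij => by
      have h1 := (hz i hi).2.2
      have h2 := (hz j hj).2.1
      have h3 := dist_triangle x (z i) (z j)
      have h4 : (i : ℝ) + 1 ≤ j := by exact_mod_cast hij
      nlinarith)
  rw [Measure.addHaar_ball_of_pos _ _ hδ, hvol] at hcard
  have h5 := ENNReal.toReal_mono ENNReal.ofReal_ne_top hcard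
  rw [ENNReal.toReal_mul, ENNReal.toReal_mul, ENNReal.toReal_ofReal hm,
    ENNReal.toReal_ofReal (by positivity), ENNReal.toReal_natCast, finrank_euclideanSpace,
    Fintype.card_fin] at h5
  have h6 : dist x y ≤ n * (7 * δ) := by
    have := Nat.lt_floor_add_one (dist x y / (7 * δ))
    rw [div_lt_iff₀ h7] at this
    rw [hn]; push_cast; exact this.le
  change (n : ℝ) * (δ ^ d * volume.real (ball (0 : EuclideanSpace ℝ (Fin d)) 1)) ≤ m at h5
  calc _ ≤ (n * (7 * δ)) * (volume.real (ball (0 : EuclideanSpace ℝ (Fin d)) 1) * δ ^ d) := by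
        gcongr
    _ = 7 * δ * (n * (δ ^ d * volume.real (ball (0 : EuclideanSpace ℝ (Fin d)) 1))) := by ring
    _ ≤ _ := by gcongr

/-! ### Separated pieces and the translation of one of them -/

theorem isClosed_left_of_union {d : ℕ} {A B : Set (EuclideanSpace ℝ (Fin d))} {δ : ℝ}
    (hδ : 0 < δ) (hE : IsClosed (A ∪ B)) (hAB : ∀ a ∈ A, ∀ b ∈ B, δ ≤ dist a b) :
    IsClosed A := by
  refine isClosed_of_closure_subset fun x hx => ?_
  rcases hE.closure_subset_iff.2 subset_union_left hx with h | h
  · exact h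
  · obtain ⟨a, ha, hxa⟩ := Metric.mem_closure_iff.1 hx δ hδ
    exact absurd (hAB a ha x h) (not_le.2 (by rwa [dist_comm]))

/-- The interior ball is connected, so it lies in one of the two disjoint closed pieces. It cannot
be `B`, because the ball has points at distance less than `δ` from `x ∈ A`. -/
theorem exists_ball_subset_left_of_union {d : ℕ} {A B : Set (EuclideanSpace ℝ (Fin d))} {δ : ℝ}
    (hδ : 0 < δ) (hE : A ∪ B ∈ ballClass d δ) (hAB : ∀ a ∈ A, ∀ b ∈ B, δ ≤ dist a b)
    {x : EuclideanSpace ℝ (Fin d)} (hxA : x ∈ A) (hx : x ∈ frontier (A ∪ B)) :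
    ∃ c, x ∈ sphere c δ ∧ ball c δ ⊆ A := by
  obtain ⟨hcl, hint, -⟩ := hE
  obtain ⟨c, hxc, hc⟩ := hint x hx
  have hA := isClosed_left_of_union hδ hcl hAB
  have hB : IsClosed B := isClosed_left_of_union hδ (by rwa [union_comm]) fun b hb a ha => by
    rw [dist_comm]; exact hAB a ha b hb
  refine ⟨c, hxc, ?_⟩
  rcases isPreconnected_iff_subset_of_disjoint_closed.1 (convex_ball c δ).isPreconnected A B
    hA hB hc (by
      rw [Set.eq_empty_iff_forall_notMem]
      rintro y ⟨-, hyA, hyB⟩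
      have := hAB y hyA y hyB
      rw [dist_self] at this
      linarith) with h | h
  · exact h
  · have hxcl : x ∈ closure (ball c δ) := by
      rw [closure_ball c hδ.ne']; exact sphere_subset_closedBall hxc
    obtain ⟨y, hy, hxy⟩ := Metric.mem_closure_iff.1 hxcl δ hδ
    exact absurd (hAB x hxA y (h hy)) (not_le.2 hxy)

theorem mem_frontier_of_separated {d : ℕ} {A B E' : Set (EuclideanSpace ℝ (Fin d))} {δ : ℝ}
    (hδ : 0 < δ) (hAB : ∀ a ∈ A, ∀ b ∈ B, δ ≤ dist a b)
    {x : EuclideanSpace ℝ (Fin d)} (hxA : x ∈ A) (hAE : A ⊆ E') (hx : x ∈ frontier E') :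
    x ∈ frontier (A ∪ B) := by
  refine ⟨subset_closure (Or.inl hxA), fun hi => hx.2 ?_⟩
  rw [mem_interior_iff_mem_nhds] at hi ⊢
  filter_upwards [hi, ball_mem_nhds x hδ] with y hy hyx
  rcases hy with hy | hy
  · exact hAE hy
  · exact absurd (hAB x hxA y hy) (not_le.2 (by rwa [dist_comm]))

/-- The set obtained from `A ∪ B` by translating `B`. -/
def translatedUnion {d : ℕ} (A B : Set (EuclideanSpace ℝ (Fin d)))
    (v : EuclideanSpace ℝ (Fin d)) : Set (EuclideanSpace ℝ (Fin d)) :=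
  A ∪ (fun x => x - v) ⁻¹' B

theorem preimage_sub_mem_ballClass {d : ℕ} {E : Set (EuclideanSpace ℝ (Fin d))} {δ : ℝ}
    (hE : E ∈ ballClass d δ) (v : EuclideanSpace ℝ (Fin d)) :
    (fun x => x - v) ⁻¹' E ∈ ballClass d δ := by
  obtain ⟨hcl, hint, hext⟩ := hE
  have hfr : frontier ((fun x => x - v) ⁻¹' E) = (fun x => x - v) ⁻¹' frontier E :=
    ((Homeomorph.subRight v).preimage_frontier E).symm
  have hdist : ∀ x c : EuclideanSpace ℝ (Fin d), dist x (c + v) = dist (x - v) c := fun x c => by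
    rw [dist_eq_norm, dist_eq_norm, sub_sub, add_comm c v]
  refine ⟨hcl.preimage (continuous_id.sub continuous_const), fun x hx => ?_, fun x hx => ?_⟩
  · rw [hfr] at hx
    obtain ⟨c, hc, hcE⟩ := hint _ hx
    exact ⟨c + v, (hdist x c).trans hc, fun y hy => hcE ((hdist y c).symm.trans_lt hy)⟩
  · rw [hfr] at hx
    obtain ⟨c, hc, hcE⟩ := hext _ hx
    exact ⟨c + v, (hdist x c).trans hc, fun y hy => hcE (a := y - v)
      ((hdist y c).symm.trans_lt hy)⟩

/-- The exterior ball for `A ∪ B` still works: all its points are at distance less than `2 δ` from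
`x`, so it cannot reach `B'`. -/
theorem exists_external_ball_of_far {d : ℕ} {A B B' : Set (EuclideanSpace ℝ (Fin d))} {δ : ℝ}
    (hE : A ∪ B ∈ ballClass d δ) (hB' : ∀ a ∈ A, ∀ b ∈ B', 2 * δ ≤ dist a b)
    {x : EuclideanSpace ℝ (Fin d)} (hxA : x ∈ A) (hx : x ∈ frontier (A ∪ B)) :
    ∃ c, x ∈ sphere c δ ∧ ball c δ ⊆ (A ∪ B')ᶜ := by
  obtain ⟨c, hxc, hc⟩ := hE.2.2 x hx
  refine ⟨c, hxc, fun y hy => ?_⟩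
  rintro (h | h)
  · exact hc hy (Or.inl h)
  · have h1 := hB' x hxA y h
    have h2 := mem_sphere.1 hxc
    have h3 := mem_ball'.1 hy
    linarith [dist_triangle x c y]

theorem ball_conditions_at_left {d : ℕ} {A B B' : Set (EuclideanSpace ℝ (Fin d))} {δ : ℝ}
    (hδ : 0 < δ) (hE : A ∪ B ∈ ballClass d δ) (hAB : ∀ a ∈ A, ∀ b ∈ B, δ ≤ dist a b)
    (hB' : ∀ a ∈ A, ∀ b ∈ B', 2 * δ ≤ dist a b)
    {x : EuclideanSpace ℝ (Fin d)} (hxA : x ∈ A) (hx : x ∈ frontier (A ∪ B')) :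
    (∃ c, x ∈ sphere c δ ∧ ball c δ ⊆ A ∪ B') ∧
      ∃ c, x ∈ sphere c δ ∧ ball c δ ⊆ (A ∪ B')ᶜ := by
  have hx' := mem_frontier_of_separated hδ hAB hxA subset_union_left hx
  obtain ⟨c, hc, hcA⟩ := exists_ball_subset_left_of_union hδ hE hAB hxA hx'
  exact ⟨⟨c, hc, hcA.trans subset_union_left⟩, exists_external_ball_of_far hE hB' hxA hx'⟩

section TranslatedUnion

variable {d : ℕ} {A B : Set (EuclideanSpace ℝ (Fin d))} {δ : ℝ}
  {v : EuclideanSpace ℝ (Fin d)}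

theorem preimage_sub_union_mem_ballClass (hE : A ∪ B ∈ ballClass d δ) :
    (fun x => x - v) ⁻¹' B ∪ (fun x => x - v) ⁻¹' A ∈ ballClass d δ := by
  rw [← preimage_union, union_comm]
  exact preimage_sub_mem_ballClass hE v

theorem le_dist_preimage_sub (hAB : ∀ a ∈ A, ∀ b ∈ B, δ ≤ dist a b) :
    ∀ b ∈ (fun x => x - v) ⁻¹' B, ∀ a ∈ (fun x => x - v) ⁻¹' A, δ ≤ dist b a := by
  intro b hb a ha
  have := hAB _ ha _ hb
  rwa [dist_sub_right, dist_comm] at this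

theorem translatedUnion_mem_ballClass (hδ : 0 < δ) (hE : A ∪ B ∈ ballClass d δ)
    (hAB : ∀ a ∈ A, ∀ b ∈ B, δ ≤ dist a b)
    (hv : ∀ a ∈ A, ∀ b ∈ (fun x => x - v) ⁻¹' B, 2 * δ ≤ dist a b) :
    translatedUnion A B v ∈ ballClass d δ := by
  have hE2 := preimage_sub_union_mem_ballClass (v := v) hE
  have hAB2 := le_dist_preimage_sub (v := v) hAB
  have hv2 : ∀ b ∈ (fun x => x - v) ⁻¹' B, ∀ a ∈ A, 2 * δ ≤ dist b a := fun b hb a ha => by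
    rw [dist_comm]; exact hv a ha b hb
  have hcl : IsClosed (translatedUnion A B v) :=
    (isClosed_left_of_union hδ hE.1 hAB).union (isClosed_left_of_union hδ hE2.1 hAB2)
  have key : ∀ x ∈ frontier (translatedUnion A B v),
      (∃ c, x ∈ sphere c δ ∧ ball c δ ⊆ translatedUnion A B v) ∧
      ∃ c, x ∈ sphere c δ ∧ ball c δ ⊆ (translatedUnion A B v)ᶜ := by
    intro x hx
    rcases hcl.frontier_subset hx with h | h
    · exact ball_conditions_at_left hδ hE hAB hv h hx
    -- At points of the moved piece, the roles are exchanged: the whole set is translated by `v`,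
    -- and then the piece coming from `A` is replaced by `A` itself.
    · unfold translatedUnion at hx ⊢
      rw [union_comm] at hx ⊢
      exact ball_conditions_at_left hδ hE2 hAB2 hv2 h hx
  exact ⟨hcl, fun x hx => (key x hx).1, fun x hx => (key x hx).2⟩

/-- Needed when the charge lives on the boundary: the surviving exterior ball certifies that the
point remains on the boundary. -/
theorem mem_frontier_translatedUnion_of_left (hδ : 0 < δ) (hE : A ∪ B ∈ ballClass d δ)
    (hv : ∀ a ∈ A, ∀ b ∈ (fun x => x - v) ⁻¹' B, 2 * δ ≤ dist a b)
    {x : EuclideanSpace ℝ (Fin d)} (hxA : x ∈ A) (hx : x ∈ frontier (A ∪ B)) :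
    x ∈ frontier (translatedUnion A B v) := by
  obtain ⟨c, hc, hcE⟩ := exists_external_ball_of_far hE hv hxA hx
  exact mem_frontier_of_ball_subset_compl hδ (Or.inl hxA) hc hcE

theorem mem_frontier_translatedUnion_of_right (hδ : 0 < δ) (hE : A ∪ B ∈ ballClass d δ)
    (hv : ∀ a ∈ A, ∀ b ∈ (fun x => x - v) ⁻¹' B, 2 * δ ≤ dist a b)
    {x : EuclideanSpace ℝ (Fin d)} (hxB : x ∈ B) (hx : x ∈ frontier (A ∪ B)) :
    x + v ∈ frontier (translatedUnion A B v) := by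
  have hE2 := preimage_sub_union_mem_ballClass (v := v) hE
  have hxB' : x + v ∈ (fun x => x - v) ⁻¹' B := by simpa using hxB
  have hx' : x + v ∈ frontier ((fun x => x - v) ⁻¹' B ∪ (fun x => x - v) ⁻¹' A) := by
    rw [← preimage_union, union_comm]
    have hfr : frontier ((fun x => x - v) ⁻¹' (A ∪ B)) = (fun x => x - v) ⁻¹' frontier (A ∪ B) :=
      ((Homeomorph.subRight v).preimage_frontier (A ∪ B)).symm
    rw [hfr]
    simpa using hx
  obtain ⟨c, hc, hcE⟩ := exists_external_ball_of_far hE2 (B' := A)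
    (fun b hb a ha => by rw [dist_comm]; exact hv a ha b hb) hxB' hx'
  refine mem_frontier_of_ball_subset_compl hδ (Or.inr hxB') hc ?_
  unfold translatedUnion
  rwa [union_comm]

theorem volume_translatedUnion (hδ : 0 < δ) (hE : A ∪ B ∈ ballClass d δ)
    (hAB : ∀ a ∈ A, ∀ b ∈ B, δ ≤ dist a b)
    (hv : ∀ a ∈ A, ∀ b ∈ (fun x => x - v) ⁻¹' B, 2 * δ ≤ dist a b) :
    volume (translatedUnion A B v) = volume (A ∪ B) := by
  have hB : IsClosed B := isClosed_left_of_union hδ (by rw [union_comm]; exact hE.1)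
    fun b hb a ha => by rw [dist_comm]; exact hAB a ha b hb
  have hB' : IsClosed ((fun x => x - v) ⁻¹' B) :=
    hB.preimage (continuous_id.sub continuous_const)
  have hd1 : Disjoint A B := Set.disjoint_left.2 fun x h1 h2 => by
    have := hAB x h1 x h2
    rw [dist_self] at this; linarith
  have hd2 : Disjoint A ((fun x => x - v) ⁻¹' B) := Set.disjoint_left.2 fun x h1 h2 => by
    have := hv x h1 x h2
    rw [dist_self] at this; linarith
  rw [translatedUnion, measure_union hd2 hB'.measurableSet, measure_union hd1 hB.measurableSet,
    (measurePreserving_sub_right volume v).measure_preimage hB.measurableSet.nullMeasurableSet]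

end TranslatedUnion

/-! ### Perimeter under separation of two pieces -/

section Divergence

variable {d : ℕ} {φ ψ : EuclideanSpace ℝ (Fin d) → EuclideanSpace ℝ (Fin d)}

theorem continuous_divergence (hφ : ContDiff ℝ 1 φ) : Continuous (divergence φ) := by
  unfold divergence
  refine continuous_finsetSum _ fun i _ => ?_
  have h := (hφ.continuous_fderiv one_ne_zero).clm_apply
    (continuous_const (y := EuclideanSpace.single i (1 : ℝ)))
  exact (EuclideanSpace.proj i : EuclideanSpace ℝ (Fin d) →L[ℝ] ℝ).continuous.comp h

theorem hasCompactSupport_divergence (hφ : HasCompactSupport φ) :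
    HasCompactSupport (divergence φ) :=
  (hφ.fderiv (𝕜 := ℝ)).comp_left (g := fun L : EuclideanSpace ℝ (Fin d) →L[ℝ]
    EuclideanSpace ℝ (Fin d) => ∑ i : Fin d, (L (EuclideanSpace.single i 1)) i) (by simp)

theorem integrable_divergence (hφ : ContDiff ℝ 1 φ) (hs : HasCompactSupport φ) :
    Integrable (divergence φ) :=
  (continuous_divergence hφ).integrable_of_hasCompactSupport (hasCompactSupport_divergence hs)

theorem divergence_congr {x : EuclideanSpace ℝ (Fin d)} (h : φ =ᶠ[𝓝 x] ψ) :
    divergence φ x = divergence ψ x := by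
  unfold divergence
  rw [h.fderiv_eq]

theorem divergence_comp_add_right (v x : EuclideanSpace ℝ (Fin d)) :
    divergence (fun y => φ (y + v)) x = divergence φ (x + v) := by
  unfold divergence
  rw [fderiv_comp_add_right]

theorem ofReal_setIntegral_divergence_le_perimeter (hφ : ContDiff ℝ 1 φ)
    (hs : HasCompactSupport φ) (h1 : ∀ x, ‖φ x‖ ≤ 1) (E : Set (EuclideanSpace ℝ (Fin d))) :
    ENNReal.ofReal (∫ x in E, divergence φ x) ≤ perimeter E :=
  le_iSup_of_le φ <| le_iSup_of_le hφ <| le_iSup_of_le hs <| le_iSup_of_le h1 le_rfl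

end Divergence

theorem exists_contDiff_zero_one_nhds {d : ℕ} {A B : Set (EuclideanSpace ℝ (Fin d))}
    (hA : IsClosed A) (hB : IsClosed B) (hAB : Disjoint A B) :
    ∃ χ : EuclideanSpace ℝ (Fin d) → ℝ, ContDiff ℝ 1 χ ∧ (∀ x ∈ A, ∀ᶠ y in 𝓝 x, χ y = 0) ∧
      (∀ x ∈ B, ∀ᶠ y in 𝓝 x, χ y = 1) ∧ ∀ x, χ x ∈ Icc (0 : ℝ) 1 := by
  obtain ⟨f, h0, h1, hf⟩ := exists_contMDiffMap_zero_one_nhds_of_isClosed (n := 1)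
    (modelWithCornersSelf ℝ (EuclideanSpace ℝ (Fin d))) hA hB hAB
  exact ⟨f, f.contMDiff.contDiff, fun x hx => eventually_nhdsSet_iff_forall.1 h0 x hx,
    fun x hx => eventually_nhdsSet_iff_forall.1 h1 x hx, hf⟩

/-- Separating two pieces does not increase the perimeter. -/
theorem perimeter_translatedUnion_le {d : ℕ} {A B : Set (EuclideanSpace ℝ (Fin d))}
    {v : EuclideanSpace ℝ (Fin d)} (hA : IsClosed A) (hB : IsClosed B) (hAB : Disjoint A B)
    (hAB' : Disjoint A ((fun x => x - v) ⁻¹' B)) :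
    perimeter (translatedUnion A B v) ≤ perimeter (A ∪ B) := by
  obtain ⟨χ, hχ, hχA, hχB, hχ01⟩ := exists_contDiff_zero_one_nhds hA hB hAB
  have hB' : IsClosed ((fun x => x - v) ⁻¹' B) :=
    hB.preimage (continuous_id.sub continuous_const)
  refine iSup_le fun φ => iSup_le fun hφ => iSup_le fun hs => iSup_le fun h1 => ?_
  -- A field for the separated set is pulled back to `A ∪ B`: it equals `φ` near `A` and the shifted
  -- `φ` near `B`. Being a pointwise convex combination, it keeps norm at most `1`; near the two
  -- pieces `χ` is constant and adds nothing to the divergence.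
  set ψ : EuclideanSpace ℝ (Fin d) → EuclideanSpace ℝ (Fin d) :=
    (fun x => 1 - χ x) • φ + χ • fun x => φ (x + v) with hψ_def
  have hφv : ContDiff ℝ 1 fun x => φ (x + v) := hφ.comp (contDiff_id.add contDiff_const)
  have hψ : ContDiff ℝ 1 ψ := ((contDiff_const.sub hχ).smul hφ).add (hχ.smul hφv)
  have hsv : HasCompactSupport fun x => φ (x + v) := hs.comp_homeomorph (Homeomorph.addRight v)
  have hψs : HasCompactSupport ψ := hs.smul_left.add hsv.smul_left
  have hψ1 : ∀ x, ‖ψ x‖ ≤ 1 := fun x => by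
    obtain ⟨h0, h01⟩ := hχ01 x
    calc ‖ψ x‖ ≤ ‖(1 - χ x) • φ x‖ + ‖χ x • φ (x + v)‖ := norm_add_le _ _
      _ = (1 - χ x) * ‖φ x‖ + χ x * ‖φ (x + v)‖ := by
        rw [norm_smul, norm_smul, Real.norm_of_nonneg h0, Real.norm_of_nonneg (sub_nonneg.2 h01)]
      _ ≤ (1 - χ x) * 1 + χ x * 1 := by
        gcongr
        · exact h1 _
        · exact h1 _
      _ = 1 := by ring
  have hdA : ∀ x ∈ A, divergence ψ x = divergence φ x := fun x hx =>
    divergence_congr <| (hχA x hx).mono fun y hy => by simp [hψ_def, hy]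
  have hdB : ∀ x ∈ B, divergence ψ x = divergence φ (x + v) := fun x hx =>
    (divergence_congr <| (hχB x hx).mono fun y hy => by simp [hψ_def, hy]).trans
      (divergence_comp_add_right v x)
  have hi := integrable_divergence hφ hs
  have hiψ := integrable_divergence hψ hψs
  have hshift : ∫ x in (fun x => x - v) ⁻¹' B, divergence φ x = ∫ x in B, divergence φ (x + v) := by
    have := (measurePreserving_sub_right (volume : Measure (EuclideanSpace ℝ (Fin d)))
      v).setIntegral_preimage_emb (Homeomorph.subRight v).measurableEmbedding
      (fun y => divergence φ (y + v)) B
    simpa using this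
  have key : ∫ x in translatedUnion A B v, divergence φ x = ∫ x in A ∪ B, divergence ψ x := by
    rw [translatedUnion, setIntegral_union hAB' hB'.measurableSet hi.integrableOn hi.integrableOn,
      setIntegral_union hAB hB.measurableSet hiψ.integrableOn hiψ.integrableOn, hshift,
      setIntegral_congr_fun hA.measurableSet hdA, setIntegral_congr_fun hB.measurableSet hdB]
  rw [key]
  exact ofReal_setIntegral_divergence_le_perimeter hψ hψs hψ1 _

/-! ### A perimeter bound for balls -/

theorem measureReal_closedBall_diff_le {d : ℕ} (a b : EuclideanSpace ℝ (Fin d)) {r : ℝ}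
    (hr : 0 < r) (hab : dist a b ≤ r) :
    volume.real (closedBall a r \ closedBall b r) ≤
      volume.real (ball (0 : EuclideanSpace ℝ (Fin d)) 1) * d * (2 * r) ^ (d - 1) * dist a b := by
  have hsub : closedBall a r \ closedBall b r ⊆ closedBall b (r + dist a b) \ closedBall b r :=
    sdiff_subset_sdiff_left (closedBall_subset_closedBall' le_rfl)
  have hfin : volume (closedBall b (r + dist a b) \ closedBall b r) ≠ ∞ :=
    ((measure_mono sdiff_subset).trans_lt measure_closedBall_lt_top).ne
  refine (measureReal_mono hsub hfin).trans ?_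
  rw [measureReal_sdiff (closedBall_subset_closedBall (by linarith [dist_nonneg (x := a) (y := b)]))
    measurableSet_closedBall measure_closedBall_lt_top.ne,
    Measure.addHaar_real_closedBall _ _ hr.le, Measure.addHaar_real_closedBall _ _ (by positivity),
    finrank_euclideanSpace, Fintype.card_fin, ← sub_mul]
  have h1 : (r + dist a b) ^ d - r ^ d ≤ dist a b * d * (2 * r) ^ (d - 1) := by
    refine (le_abs_self _).trans ((abs_pow_sub_pow_le _ _ _).trans ?_)
    rw [add_sub_cancel_left, abs_of_nonneg dist_nonneg]
    gcongr
    rw [abs_of_nonneg (by positivity), abs_of_pos hr]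
    exact max_le (by linarith) (by linarith)
  calc _ ≤ dist a b * d * (2 * r) ^ (d - 1) *
        volume.real (ball (0 : EuclideanSpace ℝ (Fin d)) 1) := by gcongr
    _ = _ := by ring

theorem abs_setIntegral_sub_setIntegral_le {X : Type*} [MeasurableSpace X] {μ : Measure X}
    {f : X → ℝ} (hf : Integrable f μ) (hf1 : ∀ x, ‖f x‖ ≤ 1) {S T : Set X}
    (hS : MeasurableSet S) (hT : MeasurableSet T) (hSf : μ S ≠ ∞) (hTf : μ T ≠ ∞) :
    |∫ x in S, f x ∂μ - ∫ x in T, f x ∂μ| ≤ μ.real (S \ T) + μ.real (T \ S) := by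
  rw [← integral_inter_add_sdiff hT hf.integrableOn (s := S),
    ← integral_inter_add_sdiff hS hf.integrableOn (s := T), inter_comm T S, add_sub_add_left_eq_sub]
  have h1 : ‖∫ x in S \ T, f x ∂μ‖ ≤ 1 * μ.real (S \ T) :=
    norm_setIntegral_le_of_norm_le_const ((measure_mono sdiff_subset).trans_lt hSf.lt_top)
      fun x _ => hf1 x
  have h2 : ‖∫ x in T \ S, f x ∂μ‖ ≤ 1 * μ.real (T \ S) :=
    norm_setIntegral_le_of_norm_le_const ((measure_mono sdiff_subset).trans_lt hTf.lt_top)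
      fun x _ => hf1 x
  rw [one_mul] at h1 h2
  exact (abs_sub _ _).trans (add_le_add h1 h2)

/-- The integral of a partial derivative over the ball is the derivative at `0` of the integral of
the component over the translated ball. That function of the translation is Lipschitz at `0`, since
the symmetric difference of the two balls lies in thin shells. The constant is not sharp, but only
the power of `r` matters. -/
theorem setIntegral_partial_closedBall_le {d : ℕ} (c : EuclideanSpace ℝ (Fin d)) {r : ℝ}
    (hr : 0 < r) {φ : EuclideanSpace ℝ (Fin d) → EuclideanSpace ℝ (Fin d)}
    (hφ : ContDiff ℝ 1 φ) (hs : HasCompactSupport φ) (h1 : ∀ x, ‖φ x‖ ≤ 1) (i : Fin d) :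
    ∫ x in closedBall c r, (fderiv ℝ φ x (EuclideanSpace.single i 1)) i ≤
      2 * (volume.real (ball (0 : EuclideanSpace ℝ (Fin d)) 1) * d * (2 * r) ^ (d - 1)) := by
  set e : EuclideanSpace ℝ (Fin d) := EuclideanSpace.single i 1 with he
  have hen : ‖e‖ = 1 := by simp [he]
  set f : EuclideanSpace ℝ (Fin d) → ℝ := fun x => φ x i with hf_def
  have hfc : Continuous f :=
    (EuclideanSpace.proj i : EuclideanSpace ℝ (Fin d) →L[ℝ] ℝ).continuous.comp hφ.continuous
  have hfs : HasCompactSupport f := hs.comp_left (g := fun y : EuclideanSpace ℝ (Fin d) => y i) rfl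
  have hfi : Integrable f := hfc.integrable_of_hasCompactSupport hfs
  have hf1 : ∀ x, ‖f x‖ ≤ 1 := fun x => (PiLp.norm_apply_le (φ x) i).trans (h1 x)
  have hc1 : Continuous (fderiv ℝ φ) := hφ.continuous_fderiv one_ne_zero
  obtain ⟨K, hK⟩ := (hs.fderiv (𝕜 := ℝ)).exists_bound_of_continuous hc1
  have hF'c : Continuous fun x => (fderiv ℝ φ x e) i :=
    (EuclideanSpace.proj i : EuclideanSpace ℝ (Fin d) →L[ℝ] ℝ).continuous.comp
      (hc1.clm_apply continuous_const)
  have hder : HasDerivAt (fun h : ℝ => ∫ x in closedBall c r, f (x + h • e))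
      (∫ x in closedBall c r, (fderiv ℝ φ (x + (0 : ℝ) • e) e) i) 0 := by
    refine (hasDerivAt_integral_of_dominated_loc_of_deriv_le (bound := fun _ => K)
      (F' := fun h x => (fderiv ℝ φ (x + h • e) e) i) univ_mem ?_ ?_ ?_ ?_ ?_ ?_).2
    · exact .of_forall fun h =>
        (hfc.comp (continuous_id.add continuous_const)).aestronglyMeasurable
    · simp only [zero_smul, add_zero]
      exact hfi.integrableOn
    · exact (hF'c.comp (continuous_id.add continuous_const)).aestronglyMeasurable
    · refine .of_forall fun x h _ => (PiLp.norm_apply_le _ i).trans ?_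
      refine (ContinuousLinearMap.le_opNorm _ _).trans ?_
      rw [hen, mul_one]
      exact hK _
    · exact integrable_const_iff.2 (Or.inr ⟨by simpa using measure_closedBall_lt_top⟩)
    · refine .of_forall fun x h _ => ?_
      have hd1 : HasDerivAt (fun h : ℝ => x + h • e) e h := by
        simpa using ((hasDerivAt_id h).smul_const e).const_add x
      have hd2 := ((hφ.differentiable one_ne_zero (x + h • e)).hasFDerivAt).comp_hasDerivAt h hd1
      exact ((EuclideanSpace.proj i : EuclideanSpace ℝ (Fin d) →L[ℝ] ℝ).hasFDerivAt).comp_hasDerivAt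
        h hd2
  simp only [zero_smul, add_zero] at hder
  refine (le_abs_self _).trans (hder.le_of_lip' (by positivity) ?_)
  filter_upwards [ball_mem_nhds (0 : ℝ) hr] with h hh
  have hshift : ∫ x in closedBall c r, f (x + h • e) = ∫ x in closedBall (c + h • e) r, f x := by
    have := (measurePreserving_add_right (volume : Measure (EuclideanSpace ℝ (Fin d)))
      (h • e)).setIntegral_preimage_emb (Homeomorph.addRight (h • e)).measurableEmbedding
      f (closedBall (c + h • e) r)
    rw [← this]
    congr 2
    ext x
    simp
  have hd : dist (c + h • e) c = |h| := by simp [norm_smul, hen]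
  have hh' : |h| ≤ r := by simpa using (mem_ball.1 hh).le
  have e1 := measureReal_closedBall_diff_le (c + h • e) c hr (hd.trans_le hh')
  have e2 := measureReal_closedBall_diff_le c (c + h • e) hr
    (by rw [dist_comm]; exact hd.trans_le hh')
  rw [dist_comm c] at e2
  rw [hd] at e1 e2
  simp only [zero_smul, add_zero, sub_zero, Real.norm_eq_abs]
  rw [hshift]
  refine (abs_setIntegral_sub_setIntegral_le hfi hf1 measurableSet_closedBall
    measurableSet_closedBall measure_closedBall_lt_top.ne measure_closedBall_lt_top.ne).trans ?_
  linarith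

theorem setIntegral_divergence_closedBall_le {d : ℕ} (c : EuclideanSpace ℝ (Fin d)) {r : ℝ}
    (hr : 0 < r) {φ : EuclideanSpace ℝ (Fin d) → EuclideanSpace ℝ (Fin d)}
    (hφ : ContDiff ℝ 1 φ) (hs : HasCompactSupport φ) (h1 : ∀ x, ‖φ x‖ ≤ 1) :
    ∫ x in closedBall c r, divergence φ x ≤
      2 * d ^ 2 * volume.real (ball (0 : EuclideanSpace ℝ (Fin d)) 1) * (2 * r) ^ (d - 1) := by
  unfold divergence
  rw [integral_finsetSum]
  · refine (Finset.sum_le_sum fun i _ =>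
      setIntegral_partial_closedBall_le c hr hφ hs h1 i).trans (le_of_eq ?_)
    simp only [Finset.sum_const, Finset.card_univ, Fintype.card_fin, nsmul_eq_mul]
    ring
  · intro i _
    have hc1 : Continuous (fderiv ℝ φ) := hφ.continuous_fderiv one_ne_zero
    exact ((EuclideanSpace.proj i : EuclideanSpace ℝ (Fin d) →L[ℝ] ℝ).continuous.comp
      (hc1.clm_apply continuous_const)).continuousOn.integrableOn_compact (isCompact_closedBall c r)

/-! ### Riesz energy: restriction, transport and splitting of charges -/

theorem measurable_rieszKernel {d : ℕ} (α : ℝ) :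
    Measurable fun p : EuclideanSpace ℝ (Fin d) × EuclideanSpace ℝ (Fin d) =>
      ((edist p.1 p.2) ^ α)⁻¹ :=
  ((measurable_fst.edist measurable_snd).pow_const α).inv

theorem rieszKernel_le {d : ℕ} {α : ℝ} (hα : 0 ≤ α) {x y : EuclideanSpace ℝ (Fin d)} {R : ℝ}
    (h : R ≤ dist x y) : ((edist x y) ^ α)⁻¹ ≤ (ENNReal.ofReal R ^ α)⁻¹ := by
  rw [edist_dist]
  exact ENNReal.inv_le_inv.2 (ENNReal.rpow_le_rpow (ENNReal.ofReal_le_ofReal h) hα)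

theorem le_rieszKernel {d : ℕ} {α : ℝ} (hα : 0 ≤ α) {x y : EuclideanSpace ℝ (Fin d)} {R : ℝ}
    (h : dist x y ≤ R) : (ENNReal.ofReal R ^ α)⁻¹ ≤ ((edist x y) ^ α)⁻¹ := by
  rw [edist_dist]
  exact ENNReal.inv_le_inv.2 (ENNReal.rpow_le_rpow (ENNReal.ofReal_le_ofReal h) hα)

theorem exists_inv_rpow_le {α : ℝ} (hα : 0 < α) {ε : ℝ≥0∞} (hε : 0 < ε) (R₀ : ℝ) :
    ∃ R, R₀ ≤ R ∧ (ENNReal.ofReal R ^ α)⁻¹ ≤ ε := by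
  have h : Tendsto (fun R : ℝ => (ENNReal.ofReal R ^ α)⁻¹) atTop (𝓝 0) := by
    rw [← ENNReal.inv_top]
    exact ((ENNReal.tendsto_rpow_at_top hα).comp ENNReal.tendsto_ofReal_atTop).inv
  exact ((eventually_ge_atTop R₀).and (h.eventually_le_const hε)).exists

theorem rieszEnergyMeasure_mono {d : ℕ} (α : ℝ) {μ ν : Measure (EuclideanSpace ℝ (Fin d))}
    (h : μ ≤ ν) : rieszEnergyMeasure α μ ≤ rieszEnergyMeasure α ν :=
  lintegral_mono' h fun _ => lintegral_mono' h le_rfl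

/-- Near-optimal charges may be taken to be supported on the set. -/
theorem exists_measure_of_rieszEnergy_lt {d : ℕ} {α : ℝ} {T : Set (EuclideanSpace ℝ (Fin d))}
    (hT : MeasurableSet T) {b : ℝ≥0∞} (hb : rieszEnergy α T < b) :
    ∃ μ : Measure (EuclideanSpace ℝ (Fin d)), IsProbabilityMeasure μ ∧ μ Tᶜ = 0 ∧
      rieszEnergyMeasure α μ < b := by
  simp only [rieszEnergy, iInf_lt_iff] at hb
  obtain ⟨μ, hμ, hb⟩ := hb
  refine ⟨μ.restrict T, ⟨by simpa using hμ⟩, by simp [hT.compl],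
    (rieszEnergyMeasure_mono α Measure.restrict_le_self).trans_lt hb⟩

theorem rieszEnergy_anti {d : ℕ} {α : ℝ} {T E : Set (EuclideanSpace ℝ (Fin d))}
    (hT : MeasurableSet T) (h : T ⊆ E) : rieszEnergy α E ≤ rieszEnergy α T := by
  refine le_of_forall_gt fun b hb => ?_
  obtain ⟨μ, hμ, hμT, hb⟩ := exists_measure_of_rieszEnergy_lt hT hb
  have hE : μ E = 1 :=
    le_antisymm prob_le_one (((prob_compl_eq_zero_iff hT).1 hμT).symm.le.trans (measure_mono h))
  exact (iInf₂_le μ hE).trans_lt hb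

theorem rieszEnergy_le_lintegral_map {d : ℕ} {α : ℝ} {T : Set (EuclideanSpace ℝ (Fin d))}
    {Y : Type*} [MeasurableSpace Y] {ν : Measure Y} [IsProbabilityMeasure ν]
    {g : Y → EuclideanSpace ℝ (Fin d)} (hg : Measurable g) (hT : MeasurableSet T)
    (hgT : ∀ᵐ y ∂ν, g y ∈ T) :
    rieszEnergy α T ≤ ∫⁻ x, ∫⁻ y, ((edist (g x) (g y)) ^ α)⁻¹ ∂ν ∂ν := by
  have := Measure.isProbabilityMeasure_map (μ := ν) hg.aemeasurable
  refine (iInf₂_le (ν.map g) ?_).trans (le_of_eq ?_)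
  · rw [Measure.map_apply hg hT]
    exact prob_compl_eq_zero_iff (hg hT) |>.1 hgT
  · rw [rieszEnergyMeasure, lintegral_map (measurable_rieszKernel α).lintegral_prod_right' hg]
    refine lintegral_congr fun x => ?_
    exact lintegral_map ((measurable_rieszKernel α).comp measurable_prodMk_left) hg

/-- Moving a part of the charge far away removes the interaction of the two parts. -/
theorem rieszEnergy_translate_add_le {d : ℕ} {α : ℝ} (hα : 0 ≤ α)
    {A B T T' : Set (EuclideanSpace ℝ (Fin d))} {v : EuclideanSpace ℝ (Fin d)} {D R : ℝ}
    (hA : MeasurableSet A) (hB : MeasurableSet B) (hAB : Disjoint A B)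
    (hT' : MeasurableSet T') (hTAB : T ⊆ A ∪ B)
    (hTA : ∀ x ∈ T, x ∈ A → x ∈ T') (hTB : ∀ x ∈ T, x ∈ B → x + v ∈ T')
    (hD : ∀ a ∈ A, ∀ b ∈ B, dist a b ≤ D) (hR : ∀ a ∈ A, ∀ b ∈ B, R ≤ dist a (b + v))
    {μ : Measure (EuclideanSpace ℝ (Fin d))} [IsProbabilityMeasure μ] (hμ : μ Tᶜ = 0) :
    rieszEnergy α T' + μ A * (μ B * (ENNReal.ofReal D ^ α)⁻¹) ≤
      rieszEnergyMeasure α μ + (ENNReal.ofReal R ^ α)⁻¹ := by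
  classical
  -- The map moving `B` by `v` and fixing `A` transports the charge onto `T'`; distances within each
  -- piece are unchanged.
  set g : EuclideanSpace ℝ (Fin d) → EuclideanSpace ℝ (Fin d) :=
    B.piecewise (fun x => x + v) id with hg_def
  have hg : Measurable g := Measurable.piecewise hB (measurable_id.add_const v) measurable_id
  have hgA : ∀ x ∈ A, g x = x := fun x hx =>
    piecewise_eq_of_notMem _ _ _ (disjoint_left.1 hAB hx)
  have hgB : ∀ x ∈ B, g x = x + v := fun x hx => piecewise_eq_of_mem _ _ _ hx
  have hae : ∀ᵐ x ∂μ, x ∈ T := hμ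
  have hgT : ∀ᵐ x ∂μ, g x ∈ T' := by
    filter_upwards [hae] with x hx
    rcases hTAB hx with h | h
    · rw [hgA x h]; exact hTA x hx h
    · rw [hgB x h]; exact hTB x hx h
  set c : ℝ≥0∞ := (ENNReal.ofReal D ^ α)⁻¹ with hc
  set ρ : ℝ≥0∞ := (ENNReal.ofReal R ^ α)⁻¹ with hρ
  -- For `x ∈ A`, `y ∈ B` the old kernel is at least `c` and the new one at most `ρ`. Only this
  -- ordering of the pair is credited with the gain, which suffices.
  have hpt : ∀ x ∈ T, ∀ y ∈ T, ((edist (g x) (g y)) ^ α)⁻¹ +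
      A.indicator 1 x * (B.indicator 1 y * c) ≤ ((edist x y) ^ α)⁻¹ + ρ := by
    intro x hx y hy
    rcases hTAB hx with hxA | hxB
    · rcases hTAB hy with hyA | hyB
      · rw [hgA x hxA, hgA y hyA, indicator_of_notMem (disjoint_left.1 hAB hyA)]
        simp
      · rw [hgA x hxA, hgB y hyB, indicator_of_mem hxA, indicator_of_mem hyB, add_comm]
        simp only [Pi.one_apply, one_mul]
        exact add_le_add (le_rieszKernel hα (hD x hxA y hyB)) (rieszKernel_le hα (hR x hxA y hyB))
    · rw [indicator_of_notMem (disjoint_right.1 hAB hxB), zero_mul, add_zero]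
      rcases hTAB hy with hyA | hyB
      · rw [hgA y hyA, hgB x hxB]
        exact le_add_left (rieszKernel_le hα (by rw [dist_comm]; exact hR y hyA x hxB))
      · rw [hgB y hyB, hgB x hxB, edist_add_right]
        exact le_self_add
  have h1 : ∀ᵐ x ∂μ, ∫⁻ y, ((edist (g x) (g y)) ^ α)⁻¹ ∂μ + A.indicator 1 x * (μ B * c) ≤
      ∫⁻ y, ((edist x y) ^ α)⁻¹ ∂μ + ρ := by
    filter_upwards [hae] with x hx
    have hle : ∫⁻ y, (((edist (g x) (g y)) ^ α)⁻¹ + A.indicator 1 x * (B.indicator 1 y * c)) ∂μ ≤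
        ∫⁻ y, (((edist x y) ^ α)⁻¹ + ρ) ∂μ :=
      lintegral_mono_ae (by filter_upwards [hae] with y hy using hpt x hx y hy)
    have hm1 : Measurable fun y => B.indicator (1 : EuclideanSpace ℝ (Fin d) → ℝ≥0∞) y := measurable_one.indicator hB
    rw [lintegral_add_right _ ((hm1.mul_const c).const_mul _),
      lintegral_const_mul _ (hm1.mul_const c), lintegral_mul_const _ hm1,
      lintegral_indicator_one hB, lintegral_add_right _ measurable_const, lintegral_const,
      measure_univ, mul_one] at hle
    exact hle
  have h2 := lintegral_mono_ae h1
  have hm2 : Measurable fun y => A.indicator (1 : EuclideanSpace ℝ (Fin d) → ℝ≥0∞) y := measurable_one.indicator hA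
  rw [lintegral_add_right _ (hm2.mul_const _), lintegral_mul_const _ hm2,
    lintegral_indicator_one hA, lintegral_add_right _ measurable_const, lintegral_const,
    measure_univ, mul_one] at h2
  exact (add_le_add_left (rieszEnergy_le_lintegral_map hg hT' hgT) _).trans h2

theorem mul_le_rieszEnergyMeasure {d : ℕ} {α : ℝ} (hα : 0 ≤ α)
    {A : Set (EuclideanSpace ℝ (Fin d))} (hA : MeasurableSet A) {D : ℝ}
    (hD : ∀ x ∈ A, ∀ y ∈ A, dist x y ≤ D) (μ : Measure (EuclideanSpace ℝ (Fin d))) :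
    (ENNReal.ofReal D ^ α)⁻¹ * μ A * μ A ≤ rieszEnergyMeasure α μ := by
  refine le_trans ?_ (rieszEnergyMeasure_mono α (Measure.restrict_le_self (μ := μ) (s := A)))
  rw [rieszEnergyMeasure, ← setLIntegral_const, ← setLIntegral_const]
  refine setLIntegral_mono' hA fun x hx => ?_
  exact setLIntegral_mono' hA fun y hy => le_rieszKernel hα (hD x hx y hy)

/-- A charge on a set covered by finitely many small balls puts a definite fraction of its mass
on a part of the set contained in one of them. -/
theorem exists_inv_card_le_measure_inter_ball {d : ℕ} {E : Set (EuclideanSpace ℝ (Fin d))}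
    {t : Finset (EuclideanSpace ℝ (Fin d))} {r : ℝ} (hE : E ⊆ ⋃ y ∈ t, ball y r)
    {μ : Measure (EuclideanSpace ℝ (Fin d))} (hμ : μ E = 1) :
    ∃ y ∈ t, (t.card : ℝ≥0∞)⁻¹ ≤ μ (E ∩ ball y r) := by
  by_contra! h
  have h1 : μ E ≤ ∑ y ∈ t, μ (E ∩ ball y r) := by
    refine (measure_mono fun x hx => ?_).trans (measure_biUnion_finset_le t _)
    obtain ⟨y, hy, hxy⟩ := mem_iUnion₂.1 (hE hx)
    exact mem_iUnion₂.2 ⟨y, hy, hx, hxy⟩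
  rcases t.eq_empty_or_nonempty with rfl | hne
  · simp [hμ] at h1
  · have h2 := ENNReal.sum_lt_sum_of_nonempty hne h
    rw [Finset.sum_const, nsmul_eq_mul, ENNReal.mul_inv_cancel
      (by simpa using hne.ne_empty) (by simp)] at h2
    rw [hμ] at h1
    exact absurd h1 (not_le.2 h2)

/-! ### Charge carriers and the energy of a minimizer -/

/-- The rules assigning to a closed set the closed subset that carries the charge, when the rule
is compatible with moving far apart the pieces of a set satisfying the `δ`-ball condition. -/
structure IsChargeCarrier {d : ℕ} (δ : ℝ)
    (κ : Set (EuclideanSpace ℝ (Fin d)) → Set (EuclideanSpace ℝ (Fin d))) : Prop where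
  frontier_subset : ∀ {E}, IsClosed E → frontier E ⊆ κ E
  subset : ∀ {E}, IsClosed E → κ E ⊆ E
  isClosed : ∀ {E}, IsClosed E → IsClosed (κ E)
  mem_left : ∀ {A B v}, A ∪ B ∈ ballClass d δ →
    (∀ a ∈ A, ∀ b ∈ (fun x => x - v) ⁻¹' B, 2 * δ ≤ dist a b) →
    ∀ x ∈ κ (A ∪ B), x ∈ A → x ∈ κ (translatedUnion A B v)
  mem_right : ∀ {A B v}, A ∪ B ∈ ballClass d δ →
    (∀ a ∈ A, ∀ b ∈ (fun x => x - v) ⁻¹' B, 2 * δ ≤ dist a b) →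
    ∀ x ∈ κ (A ∪ B), x ∈ B → x + v ∈ κ (translatedUnion A B v)

theorem isChargeCarrier_id {d : ℕ} (δ : ℝ) :
    IsChargeCarrier δ (id : Set (EuclideanSpace ℝ (Fin d)) → Set (EuclideanSpace ℝ (Fin d))) where
  frontier_subset hE := hE.frontier_subset
  subset _ := Subset.rfl
  isClosed hE := hE
  mem_left _ _ _ _ hx := Or.inl hx
  mem_right _ _ x _ hx := Or.inr (by simpa using hx)

theorem isChargeCarrier_frontier {d : ℕ} {δ : ℝ} (hδ : 0 < δ) :
    IsChargeCarrier (d := d) δ frontier where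
  frontier_subset _ := Subset.rfl
  subset hE := hE.frontier_subset
  isClosed _ := isClosed_frontier
  mem_left hE hv _ hx hxA := mem_frontier_translatedUnion_of_left hδ hE hv hxA hx
  mem_right hE hv _ hx hxB := mem_frontier_translatedUnion_of_right hδ hE hv hxB hx

/-- The perimeter plus `Q²` times the Riesz energy of the charge carrier. -/
noncomputable def chargedFunctional {d : ℕ}
    (κ : Set (EuclideanSpace ℝ (Fin d)) → Set (EuclideanSpace ℝ (Fin d))) (α Q : ℝ)
    (E : Set (EuclideanSpace ℝ (Fin d))) : ℝ≥0∞ :=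
  perimeter E + ENNReal.ofReal (Q ^ 2) * rieszEnergy α (κ E)

theorem exists_translation_far {d : ℕ} (hd : 0 < d) {E : Set (EuclideanSpace ℝ (Fin d))}
    (hE : Bornology.IsBounded E) (R : ℝ) :
    ∃ v, ∀ a ∈ E, ∀ b ∈ E, R ≤ dist a (b + v) := by
  obtain ⟨ρ, hρ⟩ := hE.exists_norm_le
  refine ⟨EuclideanSpace.single ⟨0, hd⟩ (|R| + 2 * ρ), fun a ha b hb => ?_⟩
  set v : EuclideanSpace ℝ (Fin d) := EuclideanSpace.single ⟨0, hd⟩ (|R| + 2 * ρ)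
  have hv : |R| + 2 * ρ ≤ ‖v‖ := by
    simp only [v, PiLp.norm_single, Real.norm_eq_abs]
    exact le_abs_self _
  have h1 : ‖v‖ ≤ ‖a - (b + v)‖ + ‖a‖ + ‖b‖ := by
    calc ‖v‖ = ‖a - b - (a - (b + v))‖ := by congr 1; abel
      _ ≤ ‖a - b‖ + ‖a - (b + v)‖ := norm_sub_le _ _
      _ ≤ _ := by linarith [norm_sub_le a b]
  rw [dist_eq_norm]
  linarith [hρ a ha, hρ b hb, le_abs_self R]

/-- The translated set is an admissible competitor with no larger perimeter. As the perimeter of the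
minimizer is finite, it cancels and leaves a comparison of energies. -/
theorem rieszEnergy_le_of_isVolumeMinimizer {d : ℕ} {α Q δ m : ℝ} (hδ : 0 < δ) (hQ : 0 < Q)
    {κ : Set (EuclideanSpace ℝ (Fin d)) → Set (EuclideanSpace ℝ (Fin d))}
    {A B : Set (EuclideanSpace ℝ (Fin d))} (hAB : ∀ a ∈ A, ∀ b ∈ B, δ ≤ dist a b)
    (hmin : IsVolumeMinimizer (chargedFunctional κ α Q) (ballClass d δ) m (A ∪ B))
    (hfin : chargedFunctional κ α Q (A ∪ B) ≠ ∞) {v : EuclideanSpace ℝ (Fin d)}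
    (hv : ∀ a ∈ A, ∀ b ∈ (fun x => x - v) ⁻¹' B, 2 * δ ≤ dist a b) :
    rieszEnergy α (κ (A ∪ B)) ≤ rieszEnergy α (κ (translatedUnion A B v)) := by
  obtain ⟨hE, hvol, hle⟩ := hmin
  have hA := isClosed_left_of_union hδ hE.1 hAB
  have hB : IsClosed B := isClosed_left_of_union hδ (by rw [union_comm]; exact hE.1)
    fun b hb a ha => by rw [dist_comm]; exact hAB a ha b hb
  have hd1 : Disjoint A B := Set.disjoint_left.2 fun x h1 h2 => by
    have := hAB x h1 x h2
    rw [dist_self] at this; linarith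
  have hd2 : Disjoint A ((fun x => x - v) ⁻¹' B) := Set.disjoint_left.2 fun x h1 h2 => by
    have := hv x h1 x h2
    rw [dist_self] at this; linarith
  have h1 := hle _ (translatedUnion_mem_ballClass hδ hE hAB hv)
    ((volume_translatedUnion hδ hE hAB hv).trans hvol)
  have hP := perimeter_translatedUnion_le hA hB hd1 hd2
  have hPfin : perimeter (A ∪ B) ≠ ∞ := fun h => hfin (by simp [chargedFunctional, h])
  have h2 : perimeter (A ∪ B) + ENNReal.ofReal (Q ^ 2) * rieszEnergy α (κ (A ∪ B)) ≤
      perimeter (A ∪ B) +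
        ENNReal.ofReal (Q ^ 2) * rieszEnergy α (κ (translatedUnion A B v)) :=
    h1.trans (add_le_add_left hP _)
  rw [ENNReal.add_le_add_iff_left hPfin] at h2
  exact (ENNReal.mul_le_mul_iff_right (ENNReal.ofReal_pos.2 (by positivity)).ne'
    ENNReal.ofReal_ne_top).1 h2

/-- The charge of a minimizer sits essentially on one chain class: a lower bound for its energy. -/
theorem le_rieszEnergy_of_isVolumeMinimizer {d : ℕ} (hd : 0 < d) {α Q δ m : ℝ} (hα : 0 < α)
    (hδ : 0 < δ) (hQ : 0 < Q)
    {κ : Set (EuclideanSpace ℝ (Fin d)) → Set (EuclideanSpace ℝ (Fin d))}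
    (hκ : IsChargeCarrier δ κ) {E : Set (EuclideanSpace ℝ (Fin d))}
    (hmin : IsVolumeMinimizer (chargedFunctional κ α Q) (ballClass d δ) m E)
    (hfin : chargedFunctional κ α Q E ≠ ∞) {D : ℝ}
    (hD : ∀ x ∈ E, ∀ y ∈ chainClass δ E x, ∀ z ∈ chainClass δ E x, dist y z ≤ D) :
    4⁻¹ * (ENNReal.ofReal D ^ α)⁻¹ ≤ rieszEnergy α (κ E) := by
  by_contra! hlt
  set L : ℝ≥0∞ := 4⁻¹ * (ENNReal.ofReal D ^ α)⁻¹ with hL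
  have hcl : IsClosed E := hmin.1.1
  have hbdd : Bornology.IsBounded E := hmin.1.2.1.isBounded hδ (by rw [hmin.2.1]; simp)
  obtain ⟨ρ, hρ0, hρ⟩ : ∃ ρ : ℝ, 0 < ρ ∧ ∀ a ∈ E, ∀ b ∈ E, dist a b ≤ ρ := by
    obtain ⟨ρ, hρ⟩ := Metric.isBounded_iff.1 hbdd
    exact ⟨max ρ 1, by positivity, fun a ha b hb => (hρ ha hb).trans (le_max_left _ _)⟩
  obtain ⟨t, -, ht, htE⟩ := (isCompact_of_isClosed_isBounded hcl hbdd).finite_cover_balls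
    (e := δ / 2) (by linarith)
  lift t to Finset (EuclideanSpace ℝ (Fin d)) using ht
  simp only [SetLike.mem_coe] at htE
  set c : ℝ≥0∞ := (ENNReal.ofReal ρ ^ α)⁻¹ with hc
  have hc0 : c ≠ 0 := ENNReal.inv_ne_zero.2
    (ENNReal.rpow_ne_top_of_nonneg hα.le ENNReal.ofReal_ne_top)
  have hctop : c ≠ ∞ := ENNReal.inv_ne_top.2
    (ENNReal.rpow_pos (ENNReal.ofReal_pos.2 hρ0) ENNReal.ofReal_ne_top).ne'
  set M : ℝ≥0∞ := (t.card : ℝ≥0∞) with hM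
  have hMtop : M ≠ ∞ := by simp [hM]
  set θ : ℝ≥0∞ := M⁻¹ * (2⁻¹ * c) with hθ
  have hθ0 : θ ≠ 0 := mul_ne_zero (ENNReal.inv_ne_zero.2 hMtop) (mul_ne_zero (by simp) hc0)
  -- One `ε` pays for the near-optimality of `μ`, the other for the interaction left after the
  -- translation. The threshold `θ` is the interaction of mass `1 / M` with mass `1 / 2` at distance
  -- `ρ`; it is fixed before `μ` because the cover depends only on `E`.
  obtain ⟨ε, hε0, hεL, hεθ⟩ : ∃ ε : ℝ≥0∞, 0 < ε ∧ rieszEnergy α (κ E) + ε ≤ L ∧ ε + ε ≤ θ := by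
    refine ⟨min (L - rieszEnergy α (κ E)) (θ / 2), lt_min (tsub_pos_of_lt hlt)
      (ENNReal.half_pos hθ0), ?_, ?_⟩
    · calc _ ≤ rieszEnergy α (κ E) + (L - rieszEnergy α (κ E)) := by gcongr; exact min_le_left _ _
        _ = L := add_tsub_cancel_of_le hlt.le
    · calc _ ≤ θ / 2 + θ / 2 := add_le_add (min_le_right _ _) (min_le_right _ _)
        _ = θ := ENNReal.add_halves θ
  have hItop : rieszEnergy α (κ E) ≠ ∞ := hlt.ne_top
  obtain ⟨μ, hμ, hμκ, hμε⟩ := exists_measure_of_rieszEnergy_lt (hκ.isClosed hcl).measurableSet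
    (ENNReal.lt_add_right hItop hε0.ne')
  have hμE : μ E = 1 := (prob_compl_eq_zero_iff hcl.measurableSet).1
    (measure_mono_null (compl_subset_compl.2 (hκ.subset hcl)) hμκ)
  obtain ⟨y, hyt, hy⟩ := exists_inv_card_le_measure_inter_ball htE hμE
  have hne : (E ∩ ball y (δ / 2)).Nonempty := nonempty_of_measure_ne_zero
    ((ENNReal.inv_pos.2 hMtop).trans_le hy).ne'
  obtain ⟨x, hxE, hxy⟩ := hne
  -- Points of `E` in a ball of radius `δ / 2` are less than `δ` apart, so the whole charged part of
  -- that ball lies in one class.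
  set A := chainClass δ E x with hA_def
  have hAE : A ⊆ E := chainClass_subset hxE
  have hsub : E ∩ ball y (δ / 2) ⊆ A := fun z hz =>
    mem_chainClass_of_dist_lt (y := x) .refl hz.1
      ((dist_triangle_right x z y).trans_lt (by linarith [mem_ball.1 hxy, mem_ball.1 hz.2]))
  have hAB : ∀ a ∈ A, ∀ b ∈ E \ A, δ ≤ dist a b := fun a ha b hb => by
    by_contra! h
    exact hb.2 (mem_chainClass_of_dist_lt ha hb.1 h)
  have hun : A ∪ E \ A = E := union_sdiff_cancel hAE
  have hAcl : IsClosed A := isClosed_left_of_union hδ (by rwa [hun]) hAB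
  have hBm : MeasurableSet (E \ A) := hcl.measurableSet.diff hAcl.measurableSet
  obtain ⟨R, hR1, hRε⟩ := exists_inv_rpow_le hα hε0 (2 * δ)
  obtain ⟨v, hv⟩ := exists_translation_far hd hbdd R
  have hv2 : ∀ a ∈ A, ∀ b ∈ (fun x => x - v) ⁻¹' (E \ A), 2 * δ ≤ dist a b := fun a ha b hb => by
    have := hv a (hAE ha) (b - v) hb.1
    rw [sub_add_cancel] at this
    exact hR1.trans this
  have hmin' : IsVolumeMinimizer (chargedFunctional κ α Q) (ballClass d δ) m (A ∪ E \ A) := by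
    rwa [hun]
  have hI := rieszEnergy_le_of_isVolumeMinimizer hδ hQ hAB hmin' (by rwa [hun]) hv2
  have hT'cl := (translatedUnion_mem_ballClass hδ hmin'.1 hAB hv2).1
  have hsplit := rieszEnergy_translate_add_le hα.le (D := ρ) (R := R) hAcl.measurableSet hBm
    disjoint_sdiff_right (hκ.isClosed hT'cl).measurableSet (T := κ (A ∪ E \ A))
    (hκ.subset hmin'.1.1) (hκ.mem_left hmin'.1 hv2) (hκ.mem_right hmin'.1 hv2)
    (fun a ha b hb => hρ a (hAE ha) b hb.1) (fun a ha b hb => hv a (hAE ha) b hb.1)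
    (μ := μ) (by rwa [hun])
  rw [hun] at hI
  have hprod : μ A * (μ (E \ A) * c) ≤ θ := by
    have h1 : rieszEnergy α (κ E) + μ A * (μ (E \ A) * c) ≤ rieszEnergy α (κ E) + (ε + ε) := by
      rw [← add_assoc]
      exact (add_le_add_left hI _).trans (hsplit.trans (add_le_add hμε.le hRε))
    exact ((ENNReal.add_le_add_iff_left hItop).1 h1).trans hεθ
  -- Since `μ A` is at least `1 / M`, the bound by `θ` on the interaction leaves at most half of the
  -- mass outside `A`.
  have hB2 : μ (E \ A) ≤ 2⁻¹ := by
    have h1 : M⁻¹ * (μ (E \ A) * c) ≤ M⁻¹ * (2⁻¹ * c) :=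
      (mul_le_mul_left (hy.trans (measure_mono hsub)) _).trans hprod
    have hMinv : M⁻¹ ≠ ∞ := (hy.trans_lt (measure_lt_top μ _)).ne
    have h2 := (ENNReal.mul_le_mul_iff_right (ENNReal.inv_ne_zero.2 hMtop) hMinv).1 h1
    exact (ENNReal.mul_le_mul_iff_left hc0 hctop).1 h2
  have hA2 : 2⁻¹ ≤ μ A := by
    have h1 : μ A + μ (E \ A) = 1 := by
      rw [← measure_union disjoint_sdiff_right hBm, hun, hμE]
    have h2 : (2⁻¹ : ℝ≥0∞) + 2⁻¹ ≤ μ A + 2⁻¹ := by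
      rw [ENNReal.inv_two_add_inv_two, ← h1]
      gcongr
    exact (ENNReal.add_le_add_iff_right (by simp)).1 h2
  have hfinal : L ≤ rieszEnergyMeasure α μ := by
    refine le_trans ?_ (mul_le_rieszEnergyMeasure hα.le hAcl.measurableSet
      (hD x hxE) μ)
    calc L = (ENNReal.ofReal D ^ α)⁻¹ * 2⁻¹ * 2⁻¹ := by
          have h4 : (4⁻¹ : ℝ≥0∞) = 2⁻¹ * 2⁻¹ := by
            rw [← ENNReal.mul_inv (by simp) (by simp)]; norm_num
          rw [hL, h4]; ring
      _ ≤ _ := by gcongr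
  exact absurd (hfinal.trans_lt (hμε.trans_le hεL)) (lt_irrefl _)

/-! ### Unions of distant equal balls -/

section BallUnion

variable {d N : ℕ} {c : Fin N → EuclideanSpace ℝ (Fin d)} {r δ ℓ : ℝ}

theorem isClosed_iUnion_closedBall : IsClosed (⋃ k, closedBall (c k) r) :=
  isClosed_iUnion_of_finite fun _ => isClosed_closedBall

theorem exists_mem_sphere_of_mem_frontier {x : EuclideanSpace ℝ (Fin d)}
    (hx : x ∈ frontier (⋃ k, closedBall (c k) r)) : ∃ k, x ∈ sphere (c k) r := by
  obtain ⟨k, hk⟩ := mem_iUnion.1 (isClosed_iUnion_closedBall.frontier_subset hx)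
  refine ⟨k, le_antisymm hk ?_⟩
  by_contra! h
  exact hx.2 (interior_mono (subset_iUnion _ k) (ball_subset_interior_closedBall h))

theorem exists_ball_subset_closedBall {p x : EuclideanSpace ℝ (Fin d)} (hδ : 0 < δ) (hr : δ ≤ r)
    (hx : x ∈ sphere p r) : ∃ q, x ∈ sphere q δ ∧ ball q δ ⊆ closedBall p r := by
  have hr0 : 0 < r := hδ.trans_le hr
  have hn : ‖x - p‖ = r := by rw [← dist_eq_norm]; exact hx
  refine ⟨x - (δ / r) • (x - p), ?_, ?_⟩
  · rw [mem_sphere, dist_eq_norm, sub_sub_cancel, norm_smul, hn, Real.norm_of_nonneg (by positivity)]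
    field_simp
  · refine ball_subset_closedBall.trans (closedBall_subset_closedBall' ?_)
    have : x - (δ / r) • (x - p) - p = (1 - δ / r) • (x - p) := by
      rw [sub_smul, one_smul]; abel
    rw [dist_eq_norm, this, norm_smul, hn, Real.norm_of_nonneg (by
      rw [sub_nonneg]; exact (div_le_one hr0).2 hr)]
    apply le_of_eq
    field_simp
    ring

theorem exists_ball_disjoint_closedBall {p x : EuclideanSpace ℝ (Fin d)} (hδ : 0 < δ)
    (hr : 0 < r) (hx : x ∈ sphere p r) :
    ∃ q, x ∈ sphere q δ ∧ dist q p = r + δ := by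
  have hn : ‖x - p‖ = r := by rw [← dist_eq_norm]; exact hx
  refine ⟨x + (δ / r) • (x - p), ?_, ?_⟩
  · rw [mem_sphere, dist_eq_norm, sub_add_cancel_left, norm_neg, norm_smul, hn,
      Real.norm_of_nonneg (by positivity)]
    field_simp
  · have : x + (δ / r) • (x - p) - p = (1 + δ / r) • (x - p) := by
      rw [add_smul, one_smul]; abel
    rw [dist_eq_norm, this, norm_smul, hn, Real.norm_of_nonneg (by positivity)]
    field_simp

theorem exists_external_ball_iUnion (hδ : 0 < δ) (hr : 0 < r) (hℓ : 2 * r + 2 * δ ≤ ℓ)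
    (hc : ∀ i j, i ≠ j → ℓ ≤ dist (c i) (c j)) {x : EuclideanSpace ℝ (Fin d)} {k : Fin N}
    (hx : x ∈ sphere (c k) r) :
    ∃ q, x ∈ sphere q δ ∧ ball q δ ⊆ (⋃ k, closedBall (c k) r)ᶜ := by
  obtain ⟨q, hq, hqc⟩ := exists_ball_disjoint_closedBall hδ hr hx
  refine ⟨q, hq, fun y hy hyU => ?_⟩
  obtain ⟨j, hj⟩ := mem_iUnion.1 hyU
  rw [mem_closedBall] at hj
  rw [mem_ball] at hy
  by_cases h : j = k
  · subst h
    linarith [dist_triangle_left q (c j) y]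
  · have h1 := hc j k h
    linarith [dist_triangle_left (c j) (c k) y, dist_triangle y q (c k)]

theorem sphere_subset_frontier_iUnion (hδ : 0 < δ) (hr : 0 < r) (hℓ : 2 * r + 2 * δ ≤ ℓ)
    (hc : ∀ i j, i ≠ j → ℓ ≤ dist (c i) (c j)) (k : Fin N) :
    sphere (c k) r ⊆ frontier (⋃ k, closedBall (c k) r) := fun x hx => by
  obtain ⟨q, hq, hqU⟩ := exists_external_ball_iUnion hδ hr hℓ hc hx
  exact mem_frontier_of_ball_subset_compl hδ (mem_iUnion.2 ⟨k, sphere_subset_closedBall hx⟩) hq hqU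

theorem iUnion_closedBall_mem_ballClass (hδ : 0 < δ) (hr : δ ≤ r) (hℓ : 2 * r + 2 * δ ≤ ℓ)
    (hc : ∀ i j, i ≠ j → ℓ ≤ dist (c i) (c j)) :
    (⋃ k, closedBall (c k) r) ∈ ballClass d δ := by
  refine ⟨isClosed_iUnion_closedBall, fun x hx => ?_, fun x hx => ?_⟩
  · obtain ⟨k, hk⟩ := exists_mem_sphere_of_mem_frontier hx
    obtain ⟨q, hq, hqk⟩ := exists_ball_subset_closedBall hδ hr hk
    exact ⟨q, hq, hqk.trans (subset_iUnion (fun k => closedBall (c k) r) k)⟩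
  · obtain ⟨k, hk⟩ := exists_mem_sphere_of_mem_frontier hx
    exact exists_external_ball_iUnion hδ (hδ.trans_le hr) hℓ hc hk

theorem pairwise_disjoint_closedBall (hℓ : 2 * r < ℓ)
    (hc : ∀ i j, i ≠ j → ℓ ≤ dist (c i) (c j)) :
    Pairwise (Function.onFun Disjoint fun k => closedBall (c k) r) := fun i j hij =>
  closedBall_disjoint_closedBall (by linarith [hc i j hij])

theorem volume_iUnion_closedBall (hr : 0 < r) (hℓ : 2 * r < ℓ)
    (hc : ∀ i j, i ≠ j → ℓ ≤ dist (c i) (c j)) :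
    volume (⋃ k, closedBall (c k) r) =
      ENNReal.ofReal (N * (volume.real (ball (0 : EuclideanSpace ℝ (Fin d)) 1) * r ^ d)) := by
  rw [measure_iUnion (pairwise_disjoint_closedBall hℓ hc) fun _ => measurableSet_closedBall]
  have h : ∀ k, volume (closedBall (c k) r) =
      ENNReal.ofReal (volume.real (ball (0 : EuclideanSpace ℝ (Fin d)) 1) * r ^ d) := fun k => by
    rw [Measure.addHaar_closedBall _ _ hr.le, finrank_euclideanSpace, Fintype.card_fin, mul_comm,
      ENNReal.ofReal_mul measureReal_nonneg, ofReal_measureReal measure_ball_lt_top.ne]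
  simp only [h, tsum_fintype, Finset.sum_const, Finset.card_univ, Fintype.card_fin, nsmul_eq_mul]
  rw [ENNReal.ofReal_mul (Nat.cast_nonneg _), ENNReal.ofReal_natCast]

theorem perimeter_iUnion_closedBall_le (hr : 0 < r) (hℓ : 2 * r < ℓ)
    (hc : ∀ i j, i ≠ j → ℓ ≤ dist (c i) (c j)) :
    perimeter (⋃ k, closedBall (c k) r) ≤ ENNReal.ofReal (N * (2 * d ^ 2 *
      volume.real (ball (0 : EuclideanSpace ℝ (Fin d)) 1) * (2 * r) ^ (d - 1))) := by
  refine iSup_le fun φ => iSup_le fun hφ => iSup_le fun hs => iSup_le fun h1 =>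
    ENNReal.ofReal_le_ofReal ?_
  rw [integral_iUnion (fun _ => measurableSet_closedBall) (pairwise_disjoint_closedBall hℓ hc)
    (integrable_divergence hφ hs).integrableOn, tsum_fintype]
  refine (Finset.sum_le_sum fun k _ =>
    setIntegral_divergence_closedBall_le (c k) hr hφ hs h1).trans (le_of_eq ?_)
  simp

end BallUnion

/-! ### Energy of charges on arcs -/

/-- The kernel is integrable on a segment because `α < 1`. Splitting at `s` and moving each half to
start at `0` makes the bound uniform in `s`. -/
theorem exists_lintegral_inv_edist_rpow_le {α : ℝ} (hα1 : α < 1) :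
    ∃ C : ℝ≥0∞, C ≠ ∞ ∧ ∀ s ∈ Icc (0 : ℝ) 1, ∫⁻ t in Icc (0 : ℝ) 1, ((edist s t) ^ α)⁻¹ ≤ C := by
  have hmeas : ∀ s : ℝ, Measurable fun t : ℝ => ((edist s t) ^ α)⁻¹ := fun s =>
    ((measurable_const.edist measurable_id).pow_const α).inv
  have hfin : ∫⁻ t in Icc (0 : ℝ) 1, ((edist 0 t) ^ α)⁻¹ ≠ ∞ := by
    have h := (intervalIntegral.intervalIntegrable_rpow' (a := 0) (b := 1) (r := -α)
      (by linarith)).1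
    rw [← setLIntegral_congr Ioc_ae_eq_Icc]
    have h2 := h.hasFiniteIntegral.ne
    convert h2 using 1
    refine setLIntegral_congr_fun measurableSet_Ioc fun t ht => ?_
    have ht0 : 0 < t := ht.1
    rw [Real.enorm_of_nonneg (by positivity), edist_dist, Real.dist_eq, zero_sub, abs_neg,
      abs_of_pos ht0, ENNReal.ofReal_rpow_of_pos ht0, ← ENNReal.ofReal_inv_of_pos (by positivity),
      ← Real.rpow_neg ht0.le]
  have key : ∀ s ∈ Icc (0 : ℝ) 1,
      ∫⁻ t in Icc s 1, ((edist s t) ^ α)⁻¹ ≤ ∫⁻ t in Icc (0 : ℝ) 1, ((edist 0 t) ^ α)⁻¹ := by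
    intro s hs
    have h := (measurePreserving_add_right (volume : Measure ℝ) s).setLIntegral_comp_preimage
      (measurableSet_Icc (a := s) (b := 1)) (hmeas s)
    rw [← h]
    have hpre : (fun x => x + s) ⁻¹' Icc s 1 ⊆ Icc (0 : ℝ) 1 := fun x hx => by
      simp only [mem_preimage, mem_Icc] at hx ⊢
      constructor <;> linarith [hs.1]
    refine (lintegral_mono_set hpre).trans (lintegral_mono fun t => le_of_eq ?_)
    simp [edist_dist, Real.dist_eq]
  refine ⟨2 * ∫⁻ t in Icc (0 : ℝ) 1, ((edist 0 t) ^ α)⁻¹, ENNReal.mul_ne_top (by simp) hfin,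
    fun s hs => ?_⟩
  have hleft : ∫⁻ t in Icc 0 s, ((edist s t) ^ α)⁻¹ ≤
      ∫⁻ t in Icc (0 : ℝ) 1, ((edist 0 t) ^ α)⁻¹ := by
    have h := (Measure.measurePreserving_sub_left (volume : Measure ℝ) s).setLIntegral_comp_preimage
      (measurableSet_Icc (a := 0) (b := s)) (hmeas s)
    rw [← h]
    have hpre : (fun x => s - x) ⁻¹' Icc 0 s ⊆ Icc (0 : ℝ) 1 := fun x hx => by
      simp only [mem_preimage, mem_Icc] at hx ⊢
      constructor <;> linarith [hs.2]
    refine (lintegral_mono_set hpre).trans (lintegral_mono fun t => le_of_eq ?_)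
    simp [edist_dist, Real.dist_eq]
  rw [two_mul]
  refine le_trans ?_ (add_le_add hleft (key s hs))
  rw [← Icc_union_Icc_eq_Icc hs.1 hs.2]
  exact lintegral_union_le _ _ _

/-- A quarter circle parametrized by its first coordinate, so that distances are at least those of
the parameters and the kernel on the arc is bounded by the kernel on the segment. -/
theorem exists_arc {d : ℕ} (hd : 2 ≤ d) :
    ∃ γ : ℝ → EuclideanSpace ℝ (Fin d), Continuous γ ∧ (∀ t ∈ Icc (0 : ℝ) 1, ‖γ t‖ = 1) ∧
      ∀ s t, dist s t ≤ dist (γ s) (γ t) := by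
  set i : Fin d := ⟨0, by omega⟩ with hi
  set j : Fin d := ⟨1, by omega⟩ with hj
  have hij : i ≠ j := by simp [hi, hj]
  refine ⟨fun t => EuclideanSpace.single i t + EuclideanSpace.single j (√(1 - t ^ 2)), ?_, ?_, ?_⟩
  · have h : ∀ k : Fin d, Continuous fun t : ℝ => EuclideanSpace.single k t := fun k => by
      have : (fun t : ℝ => EuclideanSpace.single k t) =
          fun t : ℝ => t • EuclideanSpace.single k (1 : ℝ) := by
        ext t; simp
      rw [this]
      exact continuous_id.smul continuous_const
    exact (h i).add ((h j).comp (by fun_prop))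
  · intro t ht
    have h1 : ‖EuclideanSpace.single i t + EuclideanSpace.single j (√(1 - t ^ 2))‖ ^ 2 = 1 := by
      rw [sq, norm_add_sq_eq_norm_sq_add_norm_sq_real (by
        simp [EuclideanSpace.inner_single_left, hij])]
      simp only [PiLp.norm_single, Real.norm_eq_abs, abs_mul_abs_self]
      rw [Real.mul_self_sqrt (by nlinarith [ht.1, ht.2])]
      ring
    exact (pow_eq_one_iff_of_nonneg (norm_nonneg _) two_ne_zero).1 h1
  · intro s t
    rw [dist_eq_norm (E := EuclideanSpace ℝ (Fin d)), Real.dist_eq]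
    refine le_trans (le_of_eq ?_) (PiLp.norm_apply_le _ i)
    simp [hij]

/-- Charging equally arcs on far apart spheres. -/
theorem rieszEnergy_iUnion_sphere_le {d N : ℕ} (hN : 0 < N) {α : ℝ}
    (hα : 0 ≤ α) {c : Fin N → EuclideanSpace ℝ (Fin d)} {r R : ℝ} (hr : 0 < r)
    (hc : ∀ i j, i ≠ j → R + 2 * r ≤ dist (c i) (c j))
    {γ : ℝ → EuclideanSpace ℝ (Fin d)} (hγ : Continuous γ)
    (hγ1 : ∀ t ∈ Icc (0 : ℝ) 1, ‖γ t‖ = 1) (hγ2 : ∀ s t, dist s t ≤ dist (γ s) (γ t))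
    {C : ℝ≥0∞} (hC : ∀ s ∈ Icc (0 : ℝ) 1, ∫⁻ t in Icc (0 : ℝ) 1, ((edist s t) ^ α)⁻¹ ≤ C) :
    rieszEnergy α (⋃ k, sphere (c k) r) ≤
      (N : ℝ≥0∞)⁻¹ * ((ENNReal.ofReal r ^ α)⁻¹ * C) + (ENNReal.ofReal R ^ α)⁻¹ := by
  have hN0 : (N : ℝ≥0∞) ≠ 0 := by simpa using hN.ne'
  set P : Measure (Fin N) := (N : ℝ≥0∞)⁻¹ • Measure.count with hP
  have : IsProbabilityMeasure P := ⟨by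
    rw [hP, Measure.smul_apply, Measure.count_univ]
    simp [ENNReal.inv_mul_cancel hN0]⟩
  set lam : Measure ℝ := volume.restrict (Icc (0 : ℝ) 1) with hlam
  have : IsProbabilityMeasure lam := ⟨by simp [hlam]⟩
  set g : Fin N × ℝ → EuclideanSpace ℝ (Fin d) := fun p => c p.1 + r • γ p.2 with hg_def
  have hg : Measurable g := ((measurable_of_finite c).comp measurable_fst).add
    ((hγ.measurable.comp measurable_snd).const_smul r)
  have hIcc : ∀ᵐ p ∂P.prod lam, p.2 ∈ Icc (0 : ℝ) 1 :=
    Measure.quasiMeasurePreserving_snd.ae (ae_restrict_mem measurableSet_Icc)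
  have hgS : ∀ p : Fin N × ℝ, p.2 ∈ Icc (0 : ℝ) 1 → g p ∈ sphere (c p.1) r := fun p hp => by
    rw [mem_sphere, dist_eq_norm, hg_def]
    simp only [add_sub_cancel_left, norm_smul, hγ1 _ hp, mul_one]
    exact Real.norm_of_nonneg hr.le
  refine (rieszEnergy_le_lintegral_map (ν := P.prod lam) hg
    (MeasurableSet.iUnion fun k => isClosed_sphere.measurableSet)
    (hIcc.mono fun p hp => mem_iUnion.2 ⟨p.1, hgS p hp⟩)).trans ?_
  set ρ : ℝ≥0∞ := (ENNReal.ofReal R ^ α)⁻¹ with hρ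
  -- On a common sphere the arc bound scales by `r`; two different spheres are at least `R` apart. A
  -- common label has probability `1 / N`, which produces the gain.
  have hpt : ∀ p : Fin N × ℝ, p.2 ∈ Icc (0 : ℝ) 1 → ∀ q : Fin N × ℝ, q.2 ∈ Icc (0 : ℝ) 1 →
      ((edist (g p) (g q)) ^ α)⁻¹ ≤ (({p.1} : Set (Fin N)).indicator 1 q.1) *
        ((ENNReal.ofReal r ^ α)⁻¹ * ((edist p.2 q.2) ^ α)⁻¹) + ρ := by
    intro p hp q hq
    by_cases h : q.1 = p.1
    · refine le_add_right ?_
      rw [indicator_of_mem (mem_singleton_iff.2 h), Pi.one_apply, one_mul,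
        ← ENNReal.mul_inv (Or.inr (ENNReal.rpow_ne_top_of_nonneg hα (edist_ne_top _ _)))
          (Or.inl (ENNReal.rpow_ne_top_of_nonneg hα ENNReal.ofReal_ne_top)),
        ← ENNReal.mul_rpow_of_nonneg _ _ hα, edist_dist p.2,
        ← ENNReal.ofReal_mul hr.le]
      refine rieszKernel_le hα ?_
      simp only [hg_def, h, dist_add_left, dist_smul₀, Real.norm_of_nonneg hr.le]
      exact mul_le_mul_of_nonneg_left (hγ2 _ _) hr.le
    · refine le_add_left (rieszKernel_le hα ?_)
      have h1 := hc p.1 q.1 (Ne.symm h)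
      have h2 := mem_sphere.1 (hgS p hp)
      have h3 := mem_sphere.1 (hgS q hq)
      have h4 := dist_triangle4 (c p.1) (g p) (g q) (c q.1)
      rw [dist_comm (c p.1) (g p)] at h4
      linarith
  have hinner : ∀ p : Fin N × ℝ, p.2 ∈ Icc (0 : ℝ) 1 →
      ∫⁻ q, ((edist (g p) (g q)) ^ α)⁻¹ ∂P.prod lam ≤
        (N : ℝ≥0∞)⁻¹ * ((ENNReal.ofReal r ^ α)⁻¹ * C) + ρ := by
    intro p hp
    refine (lintegral_mono_ae (hIcc.mono fun q hq => hpt p hp q hq)).trans ?_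
    have hm : Measurable fun t : ℝ => ((edist p.2 t) ^ α)⁻¹ :=
      ((measurable_const.edist measurable_id).pow_const α).inv
    rw [lintegral_add_right _ measurable_const, lintegral_const, measure_univ, mul_one,
      lintegral_prod_mul (f := ({p.1} : Set (Fin N)).indicator 1)
        (g := fun t => (ENNReal.ofReal r ^ α)⁻¹ * ((edist p.2 t) ^ α)⁻¹)
        (measurable_of_finite _).aemeasurable (hm.const_mul _).aemeasurable,
      lintegral_indicator_one (measurableSet_singleton _), lintegral_const_mul _ hm]
    have hPs : P {p.1} = (N : ℝ≥0∞)⁻¹ := by simp [hP]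
    rw [hPs]
    gcongr
    exact hC _ hp
  calc _ ≤ ∫⁻ _, ((N : ℝ≥0∞)⁻¹ * ((ENNReal.ofReal r ^ α)⁻¹ * C) + ρ) ∂P.prod lam :=
        lintegral_mono_ae (hIcc.mono hinner)
    _ = _ := by simp

/-! ### Competitors, comparison and choice of constants -/

/-- Competitors made of `N` equal balls, with the bounds on their perimeter and energy. -/
theorem exists_balls_competitor {d : ℕ} (hd : 2 ≤ d) {α : ℝ} (hα0 : 0 < α) (hα1 : α < 1) :
    ∃ C : ℝ, 0 < C ∧ ∀ (N : ℕ) (r δ : ℝ), 0 < N → 0 < δ → δ ≤ r →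
      ∃ E ∈ ballClass d δ,
        volume E =
          ENNReal.ofReal (N * (volume.real (ball (0 : EuclideanSpace ℝ (Fin d)) 1) * r ^ d)) ∧
        perimeter E ≤ ENNReal.ofReal (N * (C * r ^ (d - 1))) ∧
        rieszEnergy α (frontier E) ≤ ENNReal.ofReal (C / (N * r ^ α)) := by
  obtain ⟨C, hCtop, hC⟩ := exists_lintegral_inv_edist_rpow_le hα1
  obtain ⟨γ, hγ, hγ1, hγ2⟩ := exists_arc hd
  set K : ℝ := 2 * d ^ 2 * volume.real (ball (0 : EuclideanSpace ℝ (Fin d)) 1) * 2 ^ (d - 1)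
    with hK
  have hK0 : 0 ≤ K := by positivity
  refine ⟨K + (C.toReal + 1), by positivity, fun N r δ hN hδ hr => ?_⟩
  have hr0 : 0 < r := hδ.trans_le hr
  have hN0 : (0 : ℝ) < N := by exact_mod_cast hN
  -- The gap `R` is so large that the mutual interaction is at most `1 / (N r ^ α)`, absorbed by the
  -- `+ 1` in the constant; `2 * δ ≤ R` leaves room for exterior balls.
  obtain ⟨R, hR1, hR2⟩ := exists_inv_rpow_le hα0
    (ε := ENNReal.ofReal (1 / (N * r ^ α))) (ENNReal.ofReal_pos.2 (by positivity)) (2 * δ)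
  set e : EuclideanSpace ℝ (Fin d) := EuclideanSpace.single ⟨0, by omega⟩ 1 with he
  have hen : ‖e‖ = 1 := by simp [he]
  set c : Fin N → EuclideanSpace ℝ (Fin d) := fun k => ((k : ℕ) * (R + 2 * r) : ℝ) • e with hc_def
  have hc : ∀ i j, i ≠ j → R + 2 * r ≤ dist (c i) (c j) := fun i j hij => by
    have h1 : (1 : ℝ) ≤ |((i : ℕ) : ℝ) - ((j : ℕ) : ℝ)| := by
      have h2 : ((i : ℕ) : ℤ) - ((j : ℕ) : ℤ) ≠ 0 := by
        rw [sub_ne_zero]; exact fun h => hij (Fin.ext (by exact_mod_cast h))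
      exact_mod_cast Int.one_le_abs h2
    have hRr : 0 ≤ R + 2 * r := by linarith
    rw [dist_eq_norm, hc_def, ← sub_smul, ← sub_mul, norm_smul, hen, mul_one, Real.norm_eq_abs,
      abs_mul, abs_of_nonneg hRr]
    exact le_mul_of_one_le_left hRr h1
  have hℓ : 2 * r + 2 * δ ≤ R + 2 * r := by linarith
  have hℓ' : 2 * r < R + 2 * r := by linarith
  refine ⟨⋃ k, closedBall (c k) r, iUnion_closedBall_mem_ballClass hδ hr hℓ hc,
    volume_iUnion_closedBall hr0 hℓ' hc, ?_, ?_⟩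
  · refine (perimeter_iUnion_closedBall_le hr0 hℓ' hc).trans (ENNReal.ofReal_le_ofReal ?_)
    rw [mul_pow, ← mul_assoc (2 * (d : ℝ) ^ 2 * _), ← hK]
    gcongr
    linarith [ENNReal.toReal_nonneg (a := C)]
  · have hsub : (⋃ k, sphere (c k) r) ⊆ frontier (⋃ k, closedBall (c k) r) :=
      iUnion_subset fun k => sphere_subset_frontier_iUnion hδ hr0 hℓ hc k
    refine (rieszEnergy_anti (MeasurableSet.iUnion fun k => isClosed_sphere.measurableSet)
      hsub).trans ?_
    refine (rieszEnergy_iUnion_sphere_le hN hα0.le hr0 hc hγ hγ1 hγ2 hC).trans ?_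
    have h1 : (N : ℝ≥0∞)⁻¹ * ((ENNReal.ofReal r ^ α)⁻¹ * C) =
        ENNReal.ofReal (C.toReal / (N * r ^ α)) := by
      rw [ENNReal.ofReal_rpow_of_pos hr0, ← ENNReal.ofReal_natCast, ← ENNReal.ofReal_inv_of_pos hN0,
        ← ENNReal.ofReal_inv_of_pos (by positivity)]
      nth_rewrite 1 [← ENNReal.ofReal_toReal hCtop]
      rw [← ENNReal.ofReal_mul (by positivity), ← ENNReal.ofReal_mul (by positivity)]
      congr 1
      field_simp
    rw [h1]
    refine (add_le_add_right hR2 _).trans ?_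
    rw [← ENNReal.ofReal_add (by positivity) (by positivity), ← add_div]
    refine ENNReal.ofReal_le_ofReal ?_
    exact div_le_div_of_nonneg_right (by linarith) (by positivity)

/-- The energy of a ball competitor of volume `M δᵈ` bounds the infimum of the problem. -/
theorem exists_competitor_bound {d : ℕ} (hd : 2 ≤ d) {α : ℝ} (hα0 : 0 < α) (hα1 : α < 1) :
    ∃ C : ℝ, 0 < C ∧ ∀ M δ Q : ℝ, 0 < δ →
      volume.real (ball (0 : EuclideanSpace ℝ (Fin d)) 1) ≤ M →
      ∀ κ : Set (EuclideanSpace ℝ (Fin d)) → Set (EuclideanSpace ℝ (Fin d)),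
        IsChargeCarrier δ κ → ∃ E ∈ ballClass d δ, volume E = ENNReal.ofReal (M * δ ^ d) ∧
          chargedFunctional κ α Q E ≤
            ENNReal.ofReal (C * (M * δ ^ d / δ) + Q ^ 2 * (C / (M * δ ^ α))) := by
  obtain ⟨C, hC0, hC⟩ := exists_balls_competitor hd hα0 hα1
  set ω := volume.real (ball (0 : EuclideanSpace ℝ (Fin d)) 1) with hω_def
  have hω : 0 < ω := ENNReal.toReal_pos (measure_ball_pos _ _ one_pos).ne' measure_ball_lt_top.ne
  refine ⟨C / ω + 2 * ω * C, by positivity, fun M δ Q hδ hM κ hκ => ?_⟩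
  have hM0 : 0 < M := hω.trans_le hM
  have hMω : 1 ≤ M / ω := (one_le_div hω).2 hM
  -- The largest number of balls for which the radius fixed by the volume is still at least `δ`. As
  -- `M / ω ≥ 1`, rounding down loses at most a factor `2`.
  set N := ⌊M / ω⌋₊ with hN_def
  have hN : 0 < N := Nat.floor_pos.2 hMω
  have hN0 : (0 : ℝ) < N := by exact_mod_cast hN
  have hN1 : (1 : ℝ) ≤ N := by exact_mod_cast hN
  have hNle : N * ω ≤ M := (le_div_iff₀ hω).1 (Nat.floor_le (by positivity))
  have hNge : M ≤ 2 * ω * N := by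
    have h1 := (div_lt_iff₀ hω).1 (Nat.lt_floor_add_one (M / ω))
    rw [← hN_def] at h1
    nlinarith
  have hd0 : d ≠ 0 := by omega
  set r : ℝ := (M * δ ^ d / (N * ω)) ^ ((d : ℝ)⁻¹) with hr_def
  have hr0 : 0 < r := by positivity
  have hrd : r ^ d = M * δ ^ d / (N * ω) := Real.rpow_inv_natCast_pow (by positivity) hd0
  have hδr : δ ≤ r := by
    rw [← pow_le_pow_iff_left₀ hδ.le hr0.le hd0, hrd, le_div_iff₀ (by positivity), mul_comm]
    gcongr
  obtain ⟨E, hE, hvol, hP, hI⟩ := hC N r δ hN hδ hδr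
  have hNr : N * (ω * r ^ d) = M * δ ^ d := by
    rw [hrd]; field_simp
  refine ⟨E, hE, by rw [hvol, hNr], ?_⟩
  have hP' : N * (C * r ^ (d - 1)) ≤ C / ω * (M * δ ^ d / δ) := by
    have h1 : r ^ d = r ^ (d - 1) * r := (pow_sub_one_mul hd0 r).symm
    have h2 : N * (C * r ^ (d - 1)) = C / ω * (M * δ ^ d / r) := by
      rw [← hNr, h1]; field_simp
    rw [h2]
    gcongr
  have hI' : C / (N * r ^ α) ≤ 2 * ω * C / (M * δ ^ α) := by
    rw [div_le_div_iff₀ (by positivity) (by positivity)]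
    calc C * (M * δ ^ α) ≤ C * ((2 * ω * N) * r ^ α) := by gcongr
      _ = _ := by ring
  have hIκ : rieszEnergy α (κ E) ≤ ENNReal.ofReal (2 * ω * C / (M * δ ^ α)) :=
    (rieszEnergy_anti isClosed_frontier.measurableSet (hκ.frontier_subset hE.1)).trans
      (hI.trans (ENNReal.ofReal_le_ofReal hI'))
  calc chargedFunctional κ α Q E
      ≤ ENNReal.ofReal (C / ω * (M * δ ^ d / δ)) +
        ENNReal.ofReal (Q ^ 2) * ENNReal.ofReal (2 * ω * C / (M * δ ^ α)) := by
        unfold chargedFunctional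
        gcongr
        exact hP.trans (ENNReal.ofReal_le_ofReal hP')
    _ = ENNReal.ofReal (C / ω * (M * δ ^ d / δ) + Q ^ 2 * (2 * ω * C / (M * δ ^ α))) := by
        rw [← ENNReal.ofReal_mul (by positivity), ← ENNReal.ofReal_add (by positivity)
          (by positivity)]
    _ ≤ _ := by
        refine ENNReal.ofReal_le_ofReal ?_
        gcongr
        · exact le_add_of_nonneg_right (by positivity)
        · exact le_add_of_nonneg_left (by positivity)

theorem isVolumeMinimizer_energy_le {d : ℕ} (hd : 2 ≤ d) {α : ℝ} (hα0 : 0 < α) (hα1 : α < 1) :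
    ∃ C k : ℝ, 0 < C ∧ 0 < k ∧ ∀ M δ Q : ℝ, 0 < δ → 0 < Q →
      volume.real (ball (0 : EuclideanSpace ℝ (Fin d)) 1) ≤ M →
      ∀ κ : Set (EuclideanSpace ℝ (Fin d)) → Set (EuclideanSpace ℝ (Fin d)),
        IsChargeCarrier δ κ → ∀ E,
        IsVolumeMinimizer (chargedFunctional κ α Q) (ballClass d δ) (M * δ ^ d) E →
          Q ^ 2 / (4 * (k * (M ^ α * δ ^ α))) ≤
            C * (M * δ ^ d / δ) + Q ^ 2 * (C / (M * δ ^ α)) := by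
  obtain ⟨C, hC0, hC⟩ := exists_competitor_bound hd hα0 hα1
  set ω := volume.real (ball (0 : EuclideanSpace ℝ (Fin d)) 1) with hω_def
  have hω : 0 < ω := ENNReal.toReal_pos (measure_ball_pos _ _ one_pos).ne' measure_ball_lt_top.ne
  refine ⟨C, (14 / ω) ^ α, hC0, by positivity, fun M δ Q hδ hQ hM κ hκ E hmin => ?_⟩
  have hM0 : 0 < M := hω.trans_le hM
  obtain ⟨E', hE', hvol', hJ'⟩ := hC M δ Q hδ hM κ hκ
  have hJ := (hmin.2.2 E' hE' hvol').trans hJ'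
  -- Twice the radius bound `7 / ω * (M * δ)` of a chain class.
  set D : ℝ := 14 / ω * (M * δ) with hD_def
  have hD0 : 0 < D := by positivity
  have hrad : ∀ x ∈ E, ∀ y ∈ chainClass δ E x, dist x y ≤ 7 / ω * (M * δ) := fun x hx y hy => by
    have h := hmin.1.2.1.dist_le_of_mem_chainClass hδ (by positivity) hmin.2.1 hx hy
    rw [← hω_def, ← le_div_iff₀ (by positivity)] at h
    refine h.trans (le_of_eq ?_)
    field_simp
  have hlow := le_rieszEnergy_of_isVolumeMinimizer (by omega) hα0 hδ hQ hκ hmin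
    (hJ.trans_lt ENNReal.ofReal_lt_top).ne (D := D) fun x hx y hy z hz => by
      have h1 := hrad x hx y hy
      have h2 := hrad x hx z hz
      have h3 := dist_triangle_left y z x
      have h4 : D = 7 / ω * (M * δ) + 7 / ω * (M * δ) := by rw [hD_def]; ring
      linarith
  have hDα : D ^ α = (14 / ω) ^ α * (M ^ α * δ ^ α) := by
    rw [hD_def, Real.mul_rpow (by positivity) (by positivity), Real.mul_rpow hM0.le hδ.le]
  have h5 : ENNReal.ofReal (Q ^ 2 / (4 * D ^ α)) ≤ chargedFunctional κ α Q E := by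
    calc ENNReal.ofReal (Q ^ 2 / (4 * D ^ α))
        = ENNReal.ofReal (Q ^ 2) * (4⁻¹ * (ENNReal.ofReal D ^ α)⁻¹) := by
          rw [div_eq_mul_inv, ENNReal.ofReal_mul (by positivity), mul_inv,
            ENNReal.ofReal_mul (by positivity), ENNReal.ofReal_rpow_of_pos hD0,
            ENNReal.ofReal_inv_of_pos (by positivity), ENNReal.ofReal_inv_of_pos (by positivity)]
          simp
      _ ≤ ENNReal.ofReal (Q ^ 2) * rieszEnergy α (κ E) := by gcongr
      _ ≤ _ := le_add_self
  rw [← hDα]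
  exact (ENNReal.ofReal_le_ofReal_iff (by positivity)).1 (h5.trans hJ)

/-- Squaring turns the exponents of the hypothesis into the scale `M ^ (1 + α) * δ ^ (d - 1 + α)` at
which the perimeter of the competitor balances the lower bound for the energy. -/
theorem sq_lt_of_charge_bound {d : ℕ} (hd : 0 < d) {α M δ Q Q₀ : ℝ} (hα : 0 < α) (hM : 0 < M) (hδ : 0 < δ)
    (hQ₀ : 0 < Q₀)
    (h : Q / (M * δ ^ d) ^ (((d : ℝ) - 1 + α) / (2 * (d : ℝ))) >
      Q₀ * M ^ (((d : ℝ) * α + 1 - α) / (2 * (d : ℝ)))) :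
    0 < Q ∧ Q₀ ^ 2 * (M * M ^ α) * (δ ^ d / δ * δ ^ α) < Q ^ 2 := by
  have hd0 : (0 : ℝ) < d := by exact_mod_cast hd
  rw [gt_iff_lt, lt_div_iff₀ (by positivity)] at h
  refine ⟨lt_trans (by positivity) h, ?_⟩
  refine lt_of_eq_of_lt ?_ (pow_lt_pow_left₀ h (by positivity) two_ne_zero)
  rw [Real.mul_rpow hM.le (by positivity), mul_pow, mul_pow, mul_pow]
  have e1 : (M ^ (((d : ℝ) * α + 1 - α) / (2 * (d : ℝ)))) ^ 2 *
      (M ^ (((d : ℝ) - 1 + α) / (2 * (d : ℝ)))) ^ 2 = M * M ^ α := by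
    rw [← Real.rpow_mul_natCast hM.le, ← Real.rpow_mul_natCast hM.le, ← Real.rpow_add hM,
      ← Real.rpow_one_add' hM.le (by positivity)]
    congr 1
    push_cast
    field_simp
    ring
  have e2 : ((δ ^ d) ^ (((d : ℝ) - 1 + α) / (2 * (d : ℝ)))) ^ 2 = δ ^ d / δ * δ ^ α := by
    rw [← Real.rpow_natCast δ d, ← Real.rpow_mul hδ.le, ← Real.rpow_mul_natCast hδ.le,
      ← Real.rpow_sub_one hδ.ne', ← Real.rpow_add hδ]
    congr 1
    push_cast
    field_simp
  rw [← e1, ← e2]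
  ring

theorem not_exists_isVolumeMinimizer {d : ℕ} (hd : 2 ≤ d) {α : ℝ} (hα0 : 0 < α) (hα1 : α < 1) :
    ∃ c₀ Q₀ : ℝ, 0 < c₀ ∧ 0 < Q₀ ∧
      ∀ δ m Q : ℝ, 0 < δ → c₀ * δ ^ d ≤ m →
        Q / m ^ (((d : ℝ) - 1 + α) / (2 * (d : ℝ))) >
          Q₀ * (m / δ ^ d) ^ (((d : ℝ) * α + 1 - α) / (2 * (d : ℝ))) →
        ∀ κ : Set (EuclideanSpace ℝ (Fin d)) → Set (EuclideanSpace ℝ (Fin d)),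
          IsChargeCarrier δ κ →
          ¬ ∃ E, IsVolumeMinimizer (chargedFunctional κ α Q) (ballClass d δ) m E := by
  obtain ⟨C, k, hC, hk, hbound⟩ := isVolumeMinimizer_energy_le hd hα0 hα1
  set ω := volume.real (ball (0 : EuclideanSpace ℝ (Fin d)) 1) with hω_def
  have hω : 0 < ω := ENNReal.toReal_pos (measure_ball_pos _ _ one_pos).ne' measure_ball_lt_top.ne
  -- The first entry of the maximum allows at least one ball, the second gives `8 * k * C ≤ M ^ (1 -
  -- α)`. The factor `8` lets each term of the competitor be at most half of the lower bound, whose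
  -- constant is `1 / (4 * k)`; the choice of `Q₀` makes the perimeter term strictly smaller.
  refine ⟨max ω ((8 * k * C) ^ ((1 - α)⁻¹)), √(8 * k * C), by positivity, by positivity,
    fun δ m Q hδ hm hQ κ hκ ⟨E, hE⟩ => ?_⟩
  obtain ⟨M, rfl⟩ : ∃ M, m = M * δ ^ d := ⟨m / δ ^ d, by field_simp⟩
  have hM : max ω ((8 * k * C) ^ ((1 - α)⁻¹)) ≤ M := le_of_mul_le_mul_right hm (by positivity)
  have hMω : ω ≤ M := (le_max_left _ _).trans hM
  have hM0 : 0 < M := hω.trans_le hMω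
  rw [mul_div_cancel_right₀ M (by positivity)] at hQ
  obtain ⟨hQ0, hQ2⟩ := sq_lt_of_charge_bound (by omega) hα0 hM0 hδ (by positivity) hQ
  rw [Real.sq_sqrt (by positivity)] at hQ2
  have hMα : 8 * k * C * M ^ α ≤ M := by
    have h1 : 8 * k * C ≤ M ^ (1 - α) := by
      have h2 := Real.rpow_le_rpow (by positivity) ((le_max_right _ _).trans hM)
        (by linarith : 0 ≤ 1 - α)
      rwa [← Real.rpow_mul (by positivity), inv_mul_cancel₀ (by linarith), Real.rpow_one] at h2
    calc 8 * k * C * M ^ α ≤ M ^ (1 - α) * M ^ α := by gcongr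
      _ = M := by rw [← Real.rpow_add hM0]; simp
  have h := hbound M δ Q hδ hQ0 hMω κ hκ E hE
  have h1 : Q ^ 2 * (C / (M * δ ^ α)) ≤ Q ^ 2 / (8 * (k * (M ^ α * δ ^ α))) := by
    rw [div_eq_mul_inv (Q ^ 2), ← one_div]
    refine mul_le_mul_of_nonneg_left ?_ (by positivity)
    rw [div_le_div_iff₀ (by positivity) (by positivity)]
    calc C * (8 * (k * (M ^ α * δ ^ α))) = 8 * k * C * M ^ α * δ ^ α := by ring
      _ ≤ 1 * (M * δ ^ α) := by rw [one_mul]; gcongr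
  have h2 : C * (M * δ ^ d / δ) < Q ^ 2 / (8 * (k * (M ^ α * δ ^ α))) := by
    rw [lt_div_iff₀ (by positivity)]
    refine lt_of_eq_of_lt ?_ hQ2
    ring
  have h3 : Q ^ 2 / (4 * (k * (M ^ α * δ ^ α))) =
      Q ^ 2 / (8 * (k * (M ^ α * δ ^ α))) + Q ^ 2 / (8 * (k * (M ^ α * δ ^ α))) := by
    field_simp
    norm_num
  linarith

end ChargedDrops

theorem mainTheorem7 (d : ℕ) (hd : 2 ≤ d) (α : ℝ) (hα0 : 0 < α) (hα1 : α < 1) :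
    ∃ c₀ Q₀ : ℝ, 0 < c₀ ∧ 0 < Q₀ ∧
      ∀ δ m Q : ℝ, 0 < δ → c₀ * δ ^ d ≤ m →
        Q / m ^ (((d : ℝ) - 1 + α) / (2 * (d : ℝ))) >
          Q₀ * (m / δ ^ d) ^ (((d : ℝ) * α + 1 - α) / (2 * (d : ℝ))) →
        (¬ ∃ E, ChargedDrops.IsVolumeMinimizer
            (ChargedDrops.functionalF α Q) (ChargedDrops.ballClass d δ) m E) ∧
        (¬ ∃ E, ChargedDrops.IsVolumeMinimizer
            (ChargedDrops.functionalG α Q) (ChargedDrops.ballClass d δ) m E) := by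
  obtain ⟨c₀, Q₀, hc₀, hQ₀, h⟩ := ChargedDrops.not_exists_isVolumeMinimizer hd hα0 hα1
  exact ⟨c₀, Q₀, hc₀, hQ₀, fun δ m Q hδ hm hQ =>
    ⟨h δ m Q hδ hm hQ id (ChargedDrops.isChargeCarrier_id δ),
      h δ m Q hδ hm hQ frontier (ChargedDrops.isChargeCarrier_frontier hδ)⟩⟩
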